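/- Let $n\ge 1$, $p\ge 0$, and let $\mathcal G=(\mathcal V,\mathcal E)$, $\mathcal V=\{1,\dots,n\}$, be a directed graph (self-loops allowed), where $(i,j)\in\mathcal E$ means that agent $j$ can send information to agent $i$; put $\mathcal N_i^{\rm in}=\{j:(i,j)\in\mathcal E\}$ and $\mathcal N_j^{\rm out}=\{i:(i,j)\in\mathcal E\}$. Let $f_1,\dots,f_n:\mathbb R^p\to\mathbb R$. Assume: (a) $\mathcal G$ is strongly connected; (b) each $f_i$ is convex; (c) $f=\sum_{i=1}^n f_i$ attains its minimum on $\mathbb R^p$; (d) there is a constant $D$ such that $\|g\|\le D$ for every $i$, every $x\in\mathbb R^p$ and every sub-gradient $g$ of $f_i$ at $x$ (Euclidean norm). Let $A=(a_{ij})$ and $B=(b_{ij})$ be real $n\times n$ matrices with $a_{ij}>0$ if $j\in\mathcal N_i^{\rm in}$, $a_{ij}=0$ otherwise, and $\sum_j a_{ij}=1$ for all $i$; $b_{ij}>0$ if $i\in\mathcal N_j^{\rm out}$, $b_{ij}=0$ otherwise, and $\sum_i b_{ij}=1$ for all $j$. For $\epsilon\in\mathbb R$ set $$M=M(\epsilon)=\begin{bmatrix}A&\epsilon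 I\\ I-A& B-\epsilon I\end{bmatrix}\in\mathbb R^{2n\times 2n},\qquad \Upsilon=\frac{(1-|\lambda_3|)^n}{(20+8n)^n},$$ where $\lambda_3$ is the third largest eigenvalue in modulus of $M(0)$, counted with algebraic multiplicity ($|\lambda_3|:=0$ if $n=1$). Assume $0<\epsilon<\Upsilon$. Let the step-sizes satisfy $\alpha_k\ge 0$, $\sum_{k=0}^\infty\alpha_k=\infty$ and $\sum_{k=0}^\infty\alpha_k^2<\infty$. Let $\mathbf z_1^k,\dots,\mathbf z_{2n}^k\in\mathbb R^p$, $k\ge 0$, be iterates of D-DGD from an arbitrary starting point: for all $k\ge0$ and $1\le i\le 2n$, $$\mathbf z_i^{k+1}=\sum_{j=1}^{2n}[M]_{ij}\mathbf z_j^k-\alpha_k\mathbf g_i^k,$$ where $\mathbf g_i^k$ is some sub-gradient of $f_i$ at $\mathbf z_i^k$ if $1\le i\le n$, and $\mathbf g_i^k=0$ if $n+1\le i\le 2n$. Write $\mathbf y_i^k=\mathbf z_{n+i}^k$ for $1\le i\le n$, and let $\overline{\mathbf z}^k=\frac1n\sum_{j=1}^{2n}\mathbf z_j^k$. Then: 1.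 $\sum_{k=1}^\infty\alpha_k\|\mathbf z_i^k-\overline{\mathbf z}^k\|<\infty$ for $1\le i\le n$; 2. $\sum_{k=1}^\infty\alpha_k\|\mathbf z_i^k\|<\infty$ for $n+1\le i\le 2n$; 3. the agents asymptotically reach consensus at $\overline{\mathbf z}^k$: $\|\mathbf z_i^k-\overline{\mathbf z}^k\|\to0$ for $1\le i\le n$; moreover the limits exist and $\lim_{k\to\infty}\mathbf z_i^k=\lim_{k\to\infty}\overline{\mathbf z}^k=\lim_{k\to\infty}\mathbf z_j^k$ for all $1\le i,j\le n$; 4. the auxiliary variables vanish asymptotically: $\lim_{k\to\infty}\mathbf y_i^k=0$ for $1\le i\le n$. -/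

import Mathlib

open Filter Topology

namespace DDGD

/-- In-neighbors of `i`. The ordered pair `(i, j)` is an edge (`G.Adj i j`) when agent `j` can send
information to agent `i`; self-loops are allowed but not required. -/
def inNeighbors {V : Type*} (G : Digraph V) (i : V) : Set V := {j | G.Adj i j}

/-- Out-neighbors of `j`: the agents that can receive information from `j`. -/
def outNeighbors {V : Type*} (G : Digraph V) (j : V) : Set V := {i | G.Adj i j}

/-- Every vertex is joined to every other one by a directed path. -/
def StronglyConnected {V : Type*} (G : Digraph V) : Prop :=
  ∀ i j : V, Relation.ReflTransGen G.Adj i j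

/-- The row-stochastic weights `a i j`: positive exactly on in-neighbors `j` of `i`. -/
structure IsRowWeight {n : ℕ} (G : Digraph (Fin n)) (A : Matrix (Fin n) (Fin n) ℝ) : Prop where
  pos : ∀ i j, j ∈ inNeighbors G i → 0 < A i j
  zero : ∀ i j, j ∉ inNeighbors G i → A i j = 0
  row_sum : ∀ i, ∑ j, A i j = 1

/-- The column-stochastic weights `b i j`: positive exactly on out-neighbors `i` of `j`. -/
structure IsColWeight {n : ℕ} (G : Digraph (Fin n)) (B : Matrix (Fin n) (Fin n) ℝ) : Prop where
  pos : ∀ i j, i ∈ outNeighbors G j → 0 < B i j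
  zero : ∀ i j, i ∉ outNeighbors G j → B i j = 0
  col_sum : ∀ j, ∑ i, B i j = 1

/-- The `2n × 2n` weight matrix `[[A, ε I], [I - A, B - ε I]]`; the left copy of `Fin n` carries the
indices `1, …, n`, the right copy the indices `n + 1, …, 2n`. -/
def weightMatrix {n : ℕ} (A B : Matrix (Fin n) (Fin n) ℝ) (ε : ℝ) :
    Matrix (Fin n ⊕ Fin n) (Fin n ⊕ Fin n) ℝ :=
  Matrix.fromBlocks A (ε • 1) (1 - A) (B - ε • 1)

/-- Moduli of the complex eigenvalues of a real square matrix, counted with algebraic multiplicity,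
in decreasing order. -/
noncomputable def eigenvalueModuli {m : Type*} [Fintype m] [DecidableEq m]
    (M : Matrix m m ℝ) : List ℝ :=
  ((M.map (algebraMap ℝ ℂ)).charpoly.roots.map (fun μ : ℂ => ‖μ‖)).sort (fun a b => b ≤ a)

/-- `|λ₃|` for the third largest eigenvalue (in modulus) of the weight matrix with `ε = 0`.
The value is `0` when there is no third eigenvalue, i.e. when `n ≤ 1`. -/
noncomputable def absLambdaThree {n : ℕ} (A B : Matrix (Fin n) (Fin n) ℝ) : ℝ :=
  (eigenvalueModuli (weightMatrix A B 0)).getD 2 0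

/-- The bound `Υ = (1 - |λ₃|)ⁿ / (20 + 8 n)ⁿ` on the parameter `ε`. -/
noncomputable def epsBound {n : ℕ} (A B : Matrix (Fin n) (Fin n) ℝ) : ℝ :=
  1 / (20 + 8 * (n : ℝ)) ^ n * (1 - absLambdaThree A B) ^ n

/-- `g` is a sub-gradient of `f` at `x`. -/
def IsSubgradientAt {p : ℕ} (f : EuclideanSpace ℝ (Fin p) → ℝ)
    (g x : EuclideanSpace ℝ (Fin p)) : Prop :=
  ∀ y, f x + inner ℝ g (y - x) ≤ f y

/-- The standing assumptions on the network and on the local objective functions. -/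
structure Assumptions {n p : ℕ} (G : Digraph (Fin n))
    (f : Fin n → EuclideanSpace ℝ (Fin p) → ℝ) : Prop where
  strongly_connected : StronglyConnected G
  convex : ∀ i, ConvexOn ℝ Set.univ (f i)
  exists_minimizer : ∃ xstar, ∀ y, ∑ i, f i xstar ≤ ∑ i, f i y
  bounded_subgradients : ∃ D : ℝ, ∀ i x g, IsSubgradientAt (f i) g x → ‖g‖ ≤ D

/-- Step-sizes: nonnegative, with infinite sum and finite sum of squares. -/
structure IsStepSize (α : ℕ → ℝ) : Prop where
  nonneg : ∀ k, 0 ≤ α k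
  sum_eq_top : Tendsto (fun K => ∑ k ∈ Finset.range K, α k) atTop atTop
  sq_summable : Summable fun k => α k ^ 2

/-- `z` is a sequence of iterates of the D-DGD algorithm, from an arbitrary starting point:
at each step every agent `i` uses some sub-gradient `g i` of `f i` at its current state
`x i = z k (inl i)`, and the auxiliary components `y i = z k (inr i)` use no gradient. -/
def IsIterates {n p : ℕ} (f : Fin n → EuclideanSpace ℝ (Fin p) → ℝ)
    (A B : Matrix (Fin n) (Fin n) ℝ) (ε : ℝ) (α : ℕ → ℝ)
    (z : ℕ → Fin n ⊕ Fin n → EuclideanSpace ℝ (Fin p)) : Prop :=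
  ∀ k, ∃ g : Fin n → EuclideanSpace ℝ (Fin p),
    (∀ i, IsSubgradientAt (f i) (g i) (z k (Sum.inl i))) ∧
    ∀ i, z (k + 1) i =
      ∑ j, weightMatrix A B ε i j • z k j - α k • Sum.elim g (fun _ => 0) i

/-- The accumulation point: `1 / n` times the sum of all `2n` components. -/
noncomputable def accPoint {n p : ℕ} (z : ℕ → Fin n ⊕ Fin n → EuclideanSpace ℝ (Fin p)) (k : ℕ) :
    EuclideanSpace ℝ (Fin p) :=
  (1 / (n : ℝ)) • ∑ j, z k j

end DDGD

/-! Write M for the weight matrix and L for `limitMatrix`, the rank-one projection whose columns all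
equal (1/n, …, 1/n, 0, …, 0). Since M has column sums 1 and A has row sums 1, ML = LM = L. The
deviation (1 - L)z has components z_i - z̄ and y_i, and it evolves under M - L with an input of size
O(α_k). Once all eigenvalues of M - L lie in the open unit disc, the deviation is dominated by a
scalar sequence u_{k+1} = γ u_k + c α_k with γ < 1. Such a u is square-summable because α is, which
gives consensus, the vanishing of y and the summability of α_k u_k.

The spectral claim is the hard part (`eq_zero_of_eigen_outside`). Suppose |λ| ≥ 1 and (x, w) is an
eigenvector of M with total sum zero. Then y = εw satisfies (λ - A)x = y and (λ - B)y = -ε(λ - 1)x.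
Off the Perron directions, the resolvents of A and B are bounded by (3^(n-1) - 1)/(|λ| - |λ₃|)
(`le_resolvent_bound`), so x is nearly constant and y is nearly a multiple of the Perron vector ρ of
B. Pairing with the left Perron vector π of A puts λ within t/3 of 1 - t, where t = εn⟨π, ρ⟩ lies in
(0, 1]; hence |λ| < 1, a contradiction.

Finally, z̄ performs a subgradient step for f with summable errors O(α_k u_k + α_k²). A quasi-Fejér
argument makes it converge, and the agents follow. -/

namespace DDGD

open Matrix

/-! ### Resolvent bounds for contractions -/

/-- A resolvent bound on the unit circle for a contraction: if `x` is annihilated by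
`∏ (T - a)` with all `a` in the open unit disc, then `z • x - T x` controls `x`. -/
theorem le_resolvent_bound {V : Type*} [AddCommGroup V] [Module ℂ V] [FiniteDimensional ℂ V]
    (N : Seminorm ℂ V) (hN : ∀ v, N v = 0 → v = 0) (T : Module.End ℂ V)
    (hT : ∀ v, N (T v) ≤ N v) {z : ℂ} (hz : 1 ≤ ‖z‖) {d : ℝ} (hd : 0 < d) (s : Multiset ℂ)
    (hs : ∀ a ∈ s, ‖a‖ < 1 ∧ d ≤ ‖z - a‖) (x : V)
    (hx : Polynomial.aeval T (s.map fun a => Polynomial.X - Polynomial.C a).prod x = 0) :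
    N x ≤ (3 ^ Multiset.card s - 1) / d * N (z • x - T x) := by
  induction s using Multiset.induction_on generalizing x with
  | empty =>
    have : x = 0 := by simpa using hx
    simp [this]
  | cons a s ih =>
    obtain ⟨ha, hda⟩ := hs a (Multiset.mem_cons_self a s)
    have hs' : ∀ b ∈ s, ‖b‖ < 1 ∧ d ≤ ‖z - b‖ := fun b hb => hs b (Multiset.mem_cons_of_mem hb)
    -- Blaschke factor: with y = S⁻¹x, the vector x₁ = (T - a)S⁻¹x is annihilated by the product
    -- over the remaining roots, so the induction hypothesis applies to it.
    set S : Module.End ℂ V := 1 - (starRingEnd ℂ a) • T with hS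
    have hlow : ∀ v, (1 - ‖a‖) * N v ≤ N (S v) := by
      intro v
      have h1 : N v ≤ N (S v) + N ((starRingEnd ℂ a) • T v) := by
        have : v = S v + (starRingEnd ℂ a) • T v := by simp [hS]
        calc N v = N (S v + (starRingEnd ℂ a) • T v) := by rw [← this]
          _ ≤ _ := map_add_le_add _ _ _
      have h2 : N ((starRingEnd ℂ a) • T v) ≤ ‖a‖ * N v := by
        rw [map_smul_eq_mul, RCLike.norm_conj]
        exact mul_le_mul_of_nonneg_left (hT v) (norm_nonneg _)
      linarith
    have hinj : Function.Injective S := by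
      rw [injective_iff_map_eq_zero]
      intro v hv
      have h1 := hlow v
      rw [hv, map_zero] at h1
      have h2 : N v ≤ 0 := by
        by_contra h
        push Not at h
        have := mul_pos (sub_pos.2 ha) h
        linarith
      exact hN v (le_antisymm h2 (apply_nonneg N v))
    obtain ⟨y, hy⟩ := LinearMap.surjective_of_injective hinj x
    set x₁ := T y - a • y with hx₁
    set v := z • y - T y with hv
    set u := z • x - T x with hu
    have hTx : x = y - (starRingEnd ℂ a) • T y := by rw [← hy]; simp [hS]
    have haa : (starRingEnd ℂ a) * a = ((‖a‖ ^ 2 : ℝ) : ℂ) := by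
      rw [mul_comm, Complex.mul_conj, Complex.normSq_eq_norm_sq]
    have hSv : S v = u := by
      simp only [hS, hv, hu, hTx, LinearMap.sub_apply, Module.End.one_apply, LinearMap.smul_apply,
        map_sub, map_smul, smul_sub]
    have hx₁0 : Polynomial.aeval T (s.map fun a => Polynomial.X - Polynomial.C a).prod x₁ = 0 := by
      apply hinj
      rw [map_zero]
      have e1 : S = Polynomial.aeval T (1 - Polynomial.C (starRingEnd ℂ a) * Polynomial.X) := by
        simp [hS, Algebra.smul_def]
      have e2 : x₁ = Polynomial.aeval T (Polynomial.X - Polynomial.C a) y := by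
        simp [hx₁, Module.algebraMap_end_apply]
      rw [e2, e1, ← Module.End.mul_apply, ← Module.End.mul_apply, ← map_mul, ← map_mul,
        mul_comm, mul_comm (1 - _), ← mul_assoc, map_mul, Module.End.mul_apply, ← e1, hy]
      rwa [Multiset.map_cons, Multiset.prod_cons] at hx
    have hih := ih hs' x₁ hx₁0
    have hzx₁ : z • x₁ - T x₁ = T v - a • v := by
      simp only [hx₁, hv, map_sub, map_smul, smul_sub]
      rw [smul_comm z a]
      abel
    have hv1 : (1 - ‖a‖) * N v ≤ N u := hSv ▸ hlow v
    have hna := norm_nonneg a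
    have hNv := apply_nonneg N v
    have hNu := apply_nonneg N u
    have hcoef : (0 : ℝ) ≤ 1 - ‖a‖ ^ 2 := by nlinarith
    have hv2 : (1 - ‖a‖ ^ 2) * N v ≤ 2 * N u := by
      have : (1 - ‖a‖ ^ 2) * N v = (1 + ‖a‖) * ((1 - ‖a‖) * N v) := by ring
      rw [this]
      nlinarith
    have hbl : N (T v - a • v) ≤ 3 * N u := by
      have e : T v - a • v = -(a • u) + ((1 - ‖a‖ ^ 2 : ℝ) : ℂ) • T v := by
        rw [← hSv]
        simp only [hS, LinearMap.sub_apply, Module.End.one_apply, LinearMap.smul_apply, smul_sub,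
          smul_smul, Complex.ofReal_sub, ← haa, sub_smul]
        rw [mul_comm a]
        simp only [Complex.ofReal_one, one_smul]
        abel
      rw [e]
      calc N (-(a • u) + ((1 - ‖a‖ ^ 2 : ℝ) : ℂ) • T v)
          ≤ N (-(a • u)) + N (((1 - ‖a‖ ^ 2 : ℝ) : ℂ) • T v) := map_add_le_add _ _ _
        _ = ‖a‖ * N u + (1 - ‖a‖ ^ 2) * N (T v) := by
          rw [map_neg_eq_map, map_smul_eq_mul, map_smul_eq_mul, Complex.norm_real,
            Real.norm_of_nonneg hcoef]
        _ ≤ ‖a‖ * N u + (1 - ‖a‖ ^ 2) * N v := by gcongr; exact hT v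
        _ ≤ 3 * N u := by nlinarith
    -- The difference of squares |z - a|² - |1 - āz|² equals (|z|² - 1)(1 - |a|²).
    have hmoe : ‖1 - (starRingEnd ℂ a) * z‖ ≤ ‖z - a‖ := by
      have h1 : ‖1 - (starRingEnd ℂ a) * z‖ ^ 2 ≤ ‖z - a‖ ^ 2 := by
        have hz2 : 1 ≤ z.re ^ 2 + z.im ^ 2 := by
          have := Complex.sq_norm z
          rw [Complex.normSq_apply] at this
          nlinarith
        have ha2 : a.re ^ 2 + a.im ^ 2 ≤ 1 := by
          have := Complex.sq_norm a
          rw [Complex.normSq_apply] at this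
          nlinarith
        rw [Complex.sq_norm, Complex.sq_norm, Complex.normSq_apply, Complex.normSq_apply]
        simp only [Complex.sub_re, Complex.sub_im, Complex.mul_re, Complex.mul_im,
          Complex.conj_re, Complex.conj_im, Complex.one_re, Complex.one_im]
        nlinarith [mul_nonneg (sub_nonneg.2 hz2) (sub_nonneg.2 ha2)]
      exact (sq_le_sq₀ (norm_nonneg _) (norm_nonneg _)).1 h1
    have hid : (z - a) • x = (1 - (starRingEnd ℂ a) * z) • x₁ + ((1 - ‖a‖ ^ 2 : ℝ) : ℂ) • v := by
      rw [hTx, hx₁, hv, Complex.ofReal_sub, ← haa, Complex.ofReal_one]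
      module
    have hza : 0 < ‖z - a‖ := lt_of_lt_of_le hd hda
    have hNx : ‖z - a‖ * N x ≤ ‖z - a‖ * N x₁ + 2 * N u := by
      calc ‖z - a‖ * N x = N ((z - a) • x) := (map_smul_eq_mul _ _ _).symm
        _ ≤ N ((1 - (starRingEnd ℂ a) * z) • x₁) + N (((1 - ‖a‖ ^ 2 : ℝ) : ℂ) • v) := by
          rw [hid]; exact map_add_le_add _ _ _
        _ = ‖1 - (starRingEnd ℂ a) * z‖ * N x₁ + (1 - ‖a‖ ^ 2) * N v := by
          rw [map_smul_eq_mul, map_smul_eq_mul, Complex.norm_real, Real.norm_of_nonneg hcoef]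
        _ ≤ _ := by gcongr
    have hNx' : N x ≤ N x₁ + 2 / d * N u := by
      have h1 : N x ≤ N x₁ + 2 * N u / ‖z - a‖ := by
        rw [← sub_le_iff_le_add', le_div_iff₀ hza]
        linarith
      have h2 : 2 * N u / ‖z - a‖ ≤ 2 * N u / d := by gcongr
      calc N x ≤ N x₁ + 2 * N u / d := by linarith
        _ = _ := by ring
    rw [hzx₁] at hih
    -- Each root turns the constant C into 3C + 2/d; starting from 0 this gives (3^m - 1)/d.
    have hpow : (1 : ℝ) ≤ 3 ^ Multiset.card s := one_le_pow₀ (by norm_num)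
    have hC : 0 ≤ ((3 : ℝ) ^ Multiset.card s - 1) / d := div_nonneg (by linarith) hd.le
    calc N x ≤ N x₁ + 2 / d * N u := hNx'
      _ ≤ ((3 : ℝ) ^ Multiset.card s - 1) / d * (3 * N u) + 2 / d * N u := by
        have := mul_le_mul_of_nonneg_left hbl hC
        linarith
      _ = _ := by rw [Multiset.card_cons, pow_succ]; ring

theorem apply_aeval_of_apply_eq {V : Type*} [AddCommGroup V] [Module ℂ V] (T : Module.End ℂ V)
    (φ : V →ₗ[ℂ] ℂ) (hφ : ∀ v, φ (T v) = φ v) (q : Polynomial ℂ) (v : V) :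
    φ (Polynomial.aeval T q v) = q.eval 1 * φ v := by
  have hpow : ∀ (k : ℕ) (v : V), φ ((T ^ k) v) = φ v := by
    intro k
    induction k with
    | zero => simp
    | succ k ih => intro v; rw [pow_succ, Module.End.mul_apply, ih, hφ]
  induction q using Polynomial.induction_on' with
  | add p q hp hq => simp [hp, hq, add_mul]
  | monomial k a =>
    simp [Polynomial.aeval_monomial, Module.algebraMap_end_apply, hpow]

/-- A contraction `T` with a fixed vector and an invariant functional `φ` that is nonzero on every
fixed vector: the remaining eigenvalues control the resolvent of `T` on the kernel of `φ`. -/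
theorem exists_roots_resolvent_bound {V : Type*} [AddCommGroup V] [Module ℂ V]
    [FiniteDimensional ℂ V] (N : Seminorm ℂ V) (hN : ∀ v, N v = 0 → v = 0) (T : Module.End ℂ V)
    (hT : ∀ v, N (T v) ≤ N v) (φ : V →ₗ[ℂ] ℂ) (hφ : ∀ v, φ (T v) = φ v)
    (hker : ∀ v, T v = v → φ v = 0 → v = 0) {e : V} (he : e ≠ 0) (hTe : T e = e) :
    ∃ s : Multiset ℂ, T.charpoly.roots = 1 ::ₘ s ∧ Multiset.card s + 1 = Module.finrank ℂ V ∧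
      (∀ a ∈ s, ‖a‖ ≤ 1) ∧ ∀ r < 1, (∀ a ∈ s, ‖a‖ ≤ r) → ∀ z : ℂ, 1 ≤ ‖z‖ → ∀ x, φ x = 0 →
        N x ≤ (3 ^ Multiset.card s - 1) / (‖z‖ - r) * N (z • x - T x) := by
  have hmonic : T.charpoly.Monic := LinearMap.charpoly_monic T
  have hsplit : T.charpoly.Splits := IsAlgClosed.splits _
  have h1 : (1 : ℂ) ∈ T.charpoly.roots := by
    rw [Polynomial.mem_roots hmonic.ne_zero, ← Module.End.hasEigenvalue_iff_isRoot_charpoly]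
    exact Module.End.hasEigenvalue_of_hasEigenvector
      (x := e) ⟨Module.End.mem_eigenspace_iff.2 (by simp [hTe]), he⟩
  obtain ⟨s, hs⟩ := Multiset.exists_cons_of_mem h1
  have hle : ∀ a ∈ T.charpoly.roots, ‖a‖ ≤ 1 := by
    intro a ha
    rw [Polynomial.mem_roots hmonic.ne_zero, ← Module.End.hasEigenvalue_iff_isRoot_charpoly] at ha
    obtain ⟨v, hv⟩ := ha.exists_hasEigenvector
    have hpos : 0 < N v := lt_of_le_of_ne (apply_nonneg N v) fun h => hv.2 (hN v h.symm)
    have := hT v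
    rw [hv.apply_eq_smul, map_smul_eq_mul] at this
    nlinarith
  refine ⟨s, hs, ?_, fun a ha => hle a (hs ▸ Multiset.mem_cons_of_mem ha), ?_⟩
  · rw [← LinearMap.charpoly_natDegree T, hsplit.natDegree_eq_card_roots, hs, Multiset.card_cons]
  intro r hr hsr z hz x hx
  refine le_resolvent_bound N hN T hT hz (by linarith) s
    (fun a ha => ⟨(hsr a ha).trans_lt hr, ?_⟩) x ?_
  · have := norm_sub_norm_le z a
    linarith [hsr a ha]
  -- By Cayley–Hamilton q(T)x is fixed by T, and φ(q(T)x) = q(1)φ(x) = 0; hence q(T)x = 0, without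
  -- the Perron factor.
  · set q := (s.map fun a => Polynomial.X - Polynomial.C a).prod
    have hq : T.charpoly = (Polynomial.X - Polynomial.C 1) * q := by
      rw [hsplit.eq_prod_roots_of_monic hmonic, hs, Multiset.map_cons, Multiset.prod_cons]
    apply hker
    · have := LinearMap.aeval_self_charpoly T
      rw [hq, map_mul] at this
      have := congrArg (fun S : Module.End ℂ V => S x) this
      simpa [sub_eq_zero] using this
    · rw [apply_aeval_of_apply_eq T φ hφ, hx, mul_zero]

/-! ### Perron vectors of stochastic matrices -/

section Perron

variable {n : ℕ} {P : Matrix (Fin n) (Fin n) ℝ} {R : Fin n → Fin n → Prop}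

/-- A zero of v propagates along edges: if v_b = 0, the nonnegative terms of (Pv)_b all vanish, so
v_c = 0 for every edge (b, c). Strong connectivity then kills v. -/
theorem pos_of_mulVec_eq (hP : ∀ i j, 0 ≤ P i j) (hR : ∀ i j, R i j → 0 < P i j)
    (hsc : ∀ i j, Relation.ReflTransGen R i j) {v : Fin n → ℝ} (hv : ∀ i, 0 ≤ v i)
    (hfix : P *ᵥ v = v) (hne : v ≠ 0) (i : Fin n) : 0 < v i := by
  by_contra h
  have hi : v i = 0 := le_antisymm (not_lt.1 h) (hv i)
  apply hne
  funext j
  induction hsc i j with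
  | refl => exact hi
  | tail _ hbc ih =>
    rename_i b c _
    have h1 : ∑ k, P b k * v k = 0 := by
      have := congrFun hfix b
      rw [mulVec, dotProduct] at this
      simpa [ih] using this
    have h2 := (Finset.sum_eq_zero_iff_of_nonneg
      (fun k _ => mul_nonneg (hP b k) (hv k))).1 h1 c (Finset.mem_univ c)
    exact (mul_eq_zero.1 h2).resolve_left (hR b c hbc).ne'

theorem sum_mulVec_of_col_sum (hcol : ∀ j, ∑ i, P i j = 1) (v : Fin n → ℝ) :
    ∑ i, (P *ᵥ v) i = ∑ i, v i := by
  simp only [mulVec, dotProduct]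
  rw [Finset.sum_comm]
  refine Finset.sum_congr rfl fun j _ => ?_
  rw [← Finset.sum_mul, hcol, one_mul]

/-- The triangle inequality gives |v| ≤ P|v| entrywise, and unit column sums make the totals agree,
so equality holds in each entry. -/
theorem mulVec_abs_eq (hP : ∀ i j, 0 ≤ P i j) (hcol : ∀ j, ∑ i, P i j = 1) {v : Fin n → ℝ}
    (hfix : P *ᵥ v = v) : P *ᵥ (fun i => |v i|) = fun i => |v i| := by
  have hle : ∀ i ∈ Finset.univ, |v i| ≤ (P *ᵥ fun i => |v i|) i := by
    intro i _
    calc |v i| = |∑ j, P i j * v j| := by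
          conv_lhs => rw [← hfix]
          rfl
      _ ≤ ∑ j, |P i j * v j| := Finset.abs_sum_le_sum_abs _ _
      _ = _ := by simp [mulVec, dotProduct, abs_mul, abs_of_nonneg (hP i _)]
  have := (Finset.sum_eq_sum_iff_of_le hle).1 (sum_mulVec_of_col_sum hcol _).symm
  funext i
  exact (this i (Finset.mem_univ i)).symm

theorem exists_perron_vector (hn : 1 ≤ n) (hP : ∀ i j, 0 ≤ P i j) (hcol : ∀ j, ∑ i, P i j = 1)
    (hR : ∀ i j, R i j → 0 < P i j) (hsc : ∀ i j, Relation.ReflTransGen R i j) :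
    ∃ ρ : Fin n → ℝ, (∀ i, 0 < ρ i) ∧ ∑ i, ρ i = 1 ∧ P *ᵥ ρ = ρ := by
  have : Nonempty (Fin n) := ⟨⟨0, hn⟩⟩
  have hdet : (P - 1).det = 0 := by
    rw [← det_transpose]
    refine exists_mulVec_eq_zero_iff.1 ⟨fun _ => 1, ?_, ?_⟩
    · intro h
      simpa using congrFun h ⟨0, hn⟩
    · rw [transpose_sub, transpose_one, sub_mulVec, one_mulVec, sub_eq_zero]
      funext j
      simpa [mulVec, dotProduct] using hcol j
  obtain ⟨v, hv0, hv⟩ := exists_mulVec_eq_zero_iff.2 hdet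
  rw [sub_mulVec, one_mulVec, sub_eq_zero] at hv
  have habs := mulVec_abs_eq hP hcol hv
  have hpos := pos_of_mulVec_eq hP hR hsc (fun i => abs_nonneg (v i)) habs
    (fun h => hv0 (funext fun i => abs_eq_zero.1 (congrFun h i)))
  have hS : 0 < ∑ i, |v i| := Finset.sum_pos (fun i _ => hpos i) Finset.univ_nonempty
  refine ⟨(∑ i, |v i|)⁻¹ • fun i => |v i|, fun i => ?_, ?_, ?_⟩
  · exact mul_pos (inv_pos.2 hS) (hpos i)
  · simp only [Pi.smul_apply, smul_eq_mul, ← Finset.mul_sum]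
    exact inv_mul_cancel₀ hS.ne'
  · rw [mulVec_smul, habs]

/-- The vector |v| + v is a nonnegative fixed vector, hence zero or strictly positive. So v is
everywhere nonpositive or everywhere positive, and a zero sum leaves only v = 0. -/
theorem eq_zero_of_mulVec_eq (hn : 1 ≤ n) (hP : ∀ i j, 0 ≤ P i j)
    (hcol : ∀ j, ∑ i, P i j = 1) (hR : ∀ i j, R i j → 0 < P i j)
    (hsc : ∀ i j, Relation.ReflTransGen R i j) {v : Fin n → ℝ} (hfix : P *ᵥ v = v)
    (hsum : ∑ i, v i = 0) : v = 0 := by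
  have : Nonempty (Fin n) := ⟨⟨0, hn⟩⟩
  have habs := mulVec_abs_eq hP hcol hfix
  have hfix' : P *ᵥ ((fun i => |v i|) + v) = (fun i => |v i|) + v := by
    rw [mulVec_add, habs, hfix]
  have hnonneg : ∀ i, 0 ≤ ((fun i => |v i|) + v) i := fun i => by
    have := neg_abs_le (v i)
    simp only [Pi.add_apply]
    linarith
  have hnp : ∀ i, v i ≤ 0 := by
    by_cases h0 : (fun i => |v i|) + v = 0
    · intro i
      have h1 : |v i| + v i = 0 := congrFun h0 i
      linarith [abs_nonneg (v i)]
    · have hpos := pos_of_mulVec_eq hP hR hsc hnonneg hfix' h0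
      have hv : ∀ i, 0 < v i := by
        intro i
        by_contra hi
        have h1 : 0 < |v i| + v i := hpos i
        rw [abs_of_nonpos (not_lt.1 hi)] at h1
        linarith
      exact absurd hsum (Finset.sum_pos (fun i _ => hv i) Finset.univ_nonempty).ne'
  funext i
  exact (Finset.sum_eq_zero_iff_of_nonpos fun i _ => hnp i).1 hsum i (Finset.mem_univ i)

/-- The complexification of a real matrix, as an endomorphism. -/
noncomputable abbrev complexEnd {m : Type*} [Fintype m] [DecidableEq m] (P : Matrix m m ℝ) :
    Module.End ℂ (m → ℂ) :=
  Matrix.toLin' (P.map (algebraMap ℝ ℂ))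

theorem complexEnd_apply {m : Type*} [Fintype m] [DecidableEq m] (P : Matrix m m ℝ) (v : m → ℂ)
    (i : m) : complexEnd P v i = ∑ j, (P i j : ℂ) * v j := rfl

theorem re_complexEnd {v : Fin n → ℂ} (h : complexEnd P v = v) :
    P *ᵥ (fun i => (v i).re) = fun i => (v i).re := by
  funext i
  have := congrArg Complex.re (congrFun h i)
  rw [complexEnd_apply] at this
  simpa [mulVec, dotProduct] using this

theorem im_complexEnd {v : Fin n → ℂ} (h : complexEnd P v = v) :
    P *ᵥ (fun i => (v i).im) = fun i => (v i).im := by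
  funext i
  have := congrArg Complex.im (congrFun h i)
  rw [complexEnd_apply] at this
  simpa [mulVec, dotProduct] using this

theorem complex_eq_zero_of_fixed (w : Fin n → ℝ)
    (h : ∀ v : Fin n → ℝ, P *ᵥ v = v → ∑ i, w i * v i = 0 → v = 0) {v : Fin n → ℂ}
    (hfix : complexEnd P v = v) (hsum : ∑ i, (w i : ℂ) * v i = 0) : v = 0 := by
  have h1 := h _ (re_complexEnd hfix) (by simpa using congrArg Complex.re hsum)
  have h2 := h _ (im_complexEnd hfix) (by simpa using congrArg Complex.im hsum)
  funext i
  exact Complex.ext (congrFun h1 i) (congrFun h2 i)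

/-- The `ℓ¹` norm. -/
noncomputable def l1Seminorm (n : ℕ) : Seminorm ℂ (Fin n → ℂ) :=
  Seminorm.of (fun v => ∑ i, ‖v i‖)
    (fun x y => by
      rw [← Finset.sum_add_distrib]
      exact Finset.sum_le_sum fun i _ => norm_add_le _ _)
    (fun a x => by simp [Finset.mul_sum])

theorem l1Seminorm_apply (v : Fin n → ℂ) : l1Seminorm n v = ∑ i, ‖v i‖ := rfl

/-- The weighted-sum functional. -/
noncomputable def weightedSum (w : Fin n → ℝ) : (Fin n → ℂ) →ₗ[ℂ] ℂ :=
  ∑ i, (w i : ℂ) • LinearMap.proj i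

theorem weightedSum_apply (w : Fin n → ℝ) (v : Fin n → ℂ) :
    weightedSum w v = ∑ i, (w i : ℂ) * v i := by
  simp [weightedSum]

/-- Column-stochastic matrices contract the ℓ¹ norm and preserve the sum of entries; the ambient
dimension n leaves n - 1 roots besides 1. -/
theorem colStochastic_resolvent_bound (hn : 1 ≤ n) (hP : ∀ i j, 0 ≤ P i j)
    (hcol : ∀ j, ∑ i, P i j = 1) (hR : ∀ i j, R i j → 0 < P i j)
    (hsc : ∀ i j, Relation.ReflTransGen R i j) :
    ∃ s : Multiset ℂ, (P.map (algebraMap ℝ ℂ)).charpoly.roots = 1 ::ₘ s ∧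
      (∀ a ∈ s, ‖a‖ ≤ 1) ∧ ∀ r < 1, (∀ a ∈ s, ‖a‖ ≤ r) → ∀ z : ℂ, 1 ≤ ‖z‖ → ∀ x : Fin n → ℂ,
        ∑ i, x i = 0 →
        ∑ i, ‖x i‖ ≤ (3 ^ (n - 1) - 1) / (‖z‖ - r) * ∑ i, ‖(z • x - complexEnd P x) i‖ := by
  obtain ⟨ρ, hρpos, hρsum, hρ⟩ := exists_perron_vector hn hP hcol hR hsc
  obtain ⟨s, hs, hcard, hs1, hbound⟩ := exists_roots_resolvent_bound (l1Seminorm n)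
    (fun v hv => by
      rw [l1Seminorm_apply, Finset.sum_eq_zero_iff_of_nonneg fun i _ => norm_nonneg _] at hv
      funext i
      exact norm_eq_zero.1 (hv i (Finset.mem_univ i)))
    (complexEnd P)
    (fun v => by
      simp only [l1Seminorm_apply, complexEnd_apply]
      calc ∑ i, ‖∑ j, (P i j : ℂ) * v j‖ ≤ ∑ i, ∑ j, P i j * ‖v j‖ := by
            refine Finset.sum_le_sum fun i _ => (norm_sum_le _ _).trans (le_of_eq ?_)
            refine Finset.sum_congr rfl fun j _ => ?_
            rw [norm_mul, Complex.norm_real, Real.norm_of_nonneg (hP i j)]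
        _ = ∑ j, ‖v j‖ := sum_mulVec_of_col_sum hcol fun j => ‖v j‖)
    (weightedSum fun _ => 1)
    (fun v => by
      simp only [weightedSum_apply, complexEnd_apply, Complex.ofReal_one, one_mul]
      rw [Finset.sum_comm]
      refine Finset.sum_congr rfl fun j _ => ?_
      rw [← Finset.sum_mul, ← Complex.ofReal_sum, hcol, Complex.ofReal_one, one_mul])
    (fun v hv hφ => complex_eq_zero_of_fixed (fun _ => 1)
      (fun v hv hsum => eq_zero_of_mulVec_eq hn hP hcol hR hsc hv (by simpa using hsum)) hv
      (by rwa [weightedSum_apply] at hφ))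
    (e := fun i => (ρ i : ℂ))
    (fun h => (hρpos ⟨0, hn⟩).ne' (by simpa using congrFun h ⟨0, hn⟩))
    (by
      funext i
      rw [complexEnd_apply]
      have := congrFun hρ i
      simp only [mulVec, dotProduct] at this
      exact_mod_cast this)
  have hcard' : Multiset.card s = n - 1 := by
    rw [Module.finrank_fin_fun] at hcard
    omega
  rw [charpoly_toLin'] at hs
  refine ⟨s, hs, hs1, fun r hr hsr z hz x hx => ?_⟩
  have := hbound r hr hsr z hz x (by simpa [weightedSum_apply] using hx)
  rwa [hcard'] at this

/-- The dual situation: row-stochastic matrices contract the sup norm, fix constants and preserve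
the π-weighted sum. -/
theorem rowStochastic_resolvent_bound (hn : 1 ≤ n) (hP : ∀ i j, 0 ≤ P i j)
    (hrow : ∀ i, ∑ j, P i j = 1) (hR : ∀ i j, R i j → 0 < P i j)
    (hsc : ∀ i j, Relation.ReflTransGen R i j) {π : Fin n → ℝ} (hπ : ∀ i, 0 < π i) (hπP : Pᵀ *ᵥ π = π) :
    ∃ s : Multiset ℂ, (P.map (algebraMap ℝ ℂ)).charpoly.roots = 1 ::ₘ s ∧
      (∀ a ∈ s, ‖a‖ ≤ 1) ∧ ∀ r < 1, (∀ a ∈ s, ‖a‖ ≤ r) → ∀ z : ℂ, 1 ≤ ‖z‖ → ∀ x : Fin n → ℂ,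
        ∑ i, (π i : ℂ) * x i = 0 →
        ‖x‖ ≤ (3 ^ (n - 1) - 1) / (‖z‖ - r) * ‖z • x - complexEnd P x‖ := by
  have hπP' : ∀ j, ∑ i, π i * P i j = π j := fun j => by
    have := congrFun hπP j
    simp only [mulVec, dotProduct, transpose_apply] at this
    rw [← this]
    exact Finset.sum_congr rfl fun i _ => mul_comm _ _
  have hker : ∀ v : Fin n → ℝ, P *ᵥ v = v → ∑ i, π i * v i = 0 → v = 0 := by
    intro v hv hsum
    -- Conjugating by diag(π) gives a column-stochastic matrix with the same edges, which fixes (π_i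
    -- v_i).
    have := eq_zero_of_mulVec_eq (P := Matrix.of fun i j => π i * P i j * (π j)⁻¹) (R := R) hn
      (fun i j => mul_nonneg (mul_nonneg (hπ i).le (hP i j)) (inv_nonneg.2 (hπ j).le))
      (fun j => by
        simp only [of_apply]
        rw [← Finset.sum_mul, hπP', mul_inv_cancel₀ (hπ j).ne'])
      (fun i j h => mul_pos (mul_pos (hπ i) (hR i j h)) (inv_pos.2 (hπ j))) hsc
      (v := fun i => π i * v i)
      (by
        funext i
        have h1 := congrFun hv i
        simp only [mulVec, dotProduct, of_apply] at h1 ⊢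
        conv_rhs => rw [← h1, Finset.mul_sum]
        refine Finset.sum_congr rfl fun j _ => ?_
        have := (hπ j).ne'
        field_simp) hsum
    funext i
    exact (mul_eq_zero.1 (congrFun this i)).resolve_left (hπ i).ne'
  obtain ⟨s, hs, hcard, hs1, hbound⟩ := exists_roots_resolvent_bound (normSeminorm ℂ (Fin n → ℂ))
    (fun v hv => norm_eq_zero.1 hv)
    (complexEnd P)
    (fun v => by
      simp only [coe_normSeminorm]
      rw [pi_norm_le_iff_of_nonneg (norm_nonneg v)]
      intro i
      rw [complexEnd_apply]
      calc ‖∑ j, (P i j : ℂ) * v j‖ ≤ ∑ j, P i j * ‖v‖ := by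
            refine norm_sum_le_of_le _ fun j _ => ?_
            rw [norm_mul, Complex.norm_real, Real.norm_of_nonneg (hP i j)]
            exact mul_le_mul_of_nonneg_left (norm_le_pi_norm v j) (hP i j)
        _ = ‖v‖ := by rw [← Finset.sum_mul, hrow, one_mul])
    (weightedSum π)
    (fun v => by
      simp only [weightedSum_apply, complexEnd_apply, Finset.mul_sum]
      rw [Finset.sum_comm]
      refine Finset.sum_congr rfl fun j _ => ?_
      simp_rw [← mul_assoc]
      rw [← Finset.sum_mul]
      congr 1
      exact_mod_cast hπP' j)
    (fun v hv hφ => complex_eq_zero_of_fixed π hker hv (by rwa [weightedSum_apply] at hφ))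
    (e := fun _ => 1)
    (fun h => one_ne_zero (congrFun h ⟨0, hn⟩))
    (by
      funext i
      rw [complexEnd_apply]
      simp only [mul_one]
      exact_mod_cast hrow i)
  have hcard' : Multiset.card s = n - 1 := by
    rw [Module.finrank_fin_fun] at hcard
    omega
  rw [charpoly_toLin'] at hs
  refine ⟨s, hs, hs1, fun r hr hsr z hz x hx => ?_⟩
  have := hbound r hr hsr z hz x (by rwa [weightedSum_apply])
  rwa [hcard'] at this

end Perron

/-! ### The third eigenvalue and the size of ε -/

/-- At ε = 0 the weight matrix is block triangular, so its spectrum is that of A together with that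
of B. Each contributes one Perron root 1; these head the sorted list, and the third entry is the
largest remaining modulus. -/
theorem absLambdaThree_spec {n : ℕ} {A B : Matrix (Fin n) (Fin n) ℝ} {s t : Multiset ℂ}
    (hA : (A.map (algebraMap ℝ ℂ)).charpoly.roots = 1 ::ₘ s)
    (hB : (B.map (algebraMap ℝ ℂ)).charpoly.roots = 1 ::ₘ t)
    (hs : ∀ a ∈ s, ‖a‖ ≤ 1) (ht : ∀ a ∈ t, ‖a‖ ≤ 1) :
    0 ≤ absLambdaThree A B ∧ absLambdaThree A B ≤ 1 ∧ (∀ a ∈ s, ‖a‖ ≤ absLambdaThree A B) ∧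
      ∀ a ∈ t, ‖a‖ ≤ absLambdaThree A B := by
  set w : Multiset ℝ := (s + t).map fun μ : ℂ => ‖μ‖ with hw
  have hw1 : ∀ b ∈ w, b ≤ 1 := by
    intro b hb
    obtain ⟨a, ha, rfl⟩ := Multiset.mem_map.1 hb
    rcases Multiset.mem_add.1 ha with h | h
    exacts [hs a h, ht a h]
  have hw0 : ∀ b ∈ w, 0 ≤ b := by
    intro b hb
    obtain ⟨a, ha, rfl⟩ := Multiset.mem_map.1 hb
    exact norm_nonneg a
  have hmap : (weightMatrix A B 0).map (algebraMap ℝ ℂ) =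
      fromBlocks (A.map (algebraMap ℝ ℂ)) 0 ((1 - A).map (algebraMap ℝ ℂ))
        (B.map (algebraMap ℝ ℂ)) := by
    rw [weightMatrix, fromBlocks_map, zero_smul, sub_zero, Matrix.map_zero _ (map_zero _)]
  have hroots : ((weightMatrix A B 0).map (algebraMap ℝ ℂ)).charpoly.roots.map
      (fun μ : ℂ => ‖μ‖) = 1 ::ₘ 1 ::ₘ w := by
    rw [hmap, charpoly_fromBlocks_zero₁₂, Polynomial.roots_mul
      (mul_ne_zero (charpoly_monic _).ne_zero (charpoly_monic _).ne_zero), hA, hB]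
    simp [hw]
  have hlist : eigenvalueModuli (weightMatrix A B 0) =
      1 :: 1 :: w.sort (fun a b => b ≤ a) := by
    rw [eigenvalueModuli, hroots, Multiset.sort_cons, Multiset.sort_cons]
    · exact hw1
    · intro b hb
      rcases Multiset.mem_cons.1 hb with rfl | h
      exacts [le_rfl, hw1 b h]
  -- If n = 1 no root remains, and the default value 0 is returned.
  have hval : absLambdaThree A B = (w.sort (fun a b => b ≤ a)).getD 0 0 := by
    rw [absLambdaThree, hlist]
    rfl
  have hmem : ∀ b, b ∈ w.sort (fun a b => b ≤ a) ↔ b ∈ w := fun b => Multiset.mem_sort _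
  have hsorted : (w.sort (fun a b => b ≤ a)).Pairwise (fun a b => b ≤ a) :=
    Multiset.pairwise_sort _ _
  rw [hval]
  have key : ∀ b ∈ w, b ≤ (w.sort (fun a b => b ≤ a)).getD 0 0 := by
    intro b hb
    rw [← hmem] at hb
    cases hl : w.sort (fun a b => b ≤ a) with
    | nil => simp [hl] at hb
    | cons c l =>
      rw [hl] at hb hsorted
      rcases List.mem_cons.1 hb with rfl | h
      · simp
      · simpa using (List.pairwise_cons.1 hsorted).1 b h
  refine ⟨?_, ?_, fun a ha => key _ ?_, fun a ha => key _ ?_⟩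
  · cases hl : w.sort (fun a b => b ≤ a) with
    | nil => simp
    | cons c l =>
      simpa using hw0 c ((hmem c).1 (by simp [hl]))
  · cases hl : w.sort (fun a b => b ≤ a) with
    | nil => simp
    | cons c l =>
      simpa using hw1 c ((hmem c).1 (by simp [hl]))
  · exact Multiset.mem_map_of_mem _ (Multiset.mem_add.2 (Or.inl ha))
  · exact Multiset.mem_map_of_mem _ (Multiset.mem_add.2 (Or.inr ha))

/-- Turns ε < Υ into the two smallness conditions of the perturbation argument, with δ = 1 - |λ₃|
and the resolvent constant 3^(n-1) - 1. For n = 1 that constant is 0; for n ≥ 2 only δ^n ≤ δ² and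
64n·9^(n-1) ≤ (20 + 8n)^n are needed. -/
theorem small_of_lt_bound {n : ℕ} (hn : 1 ≤ n) {ε δ : ℝ} (hε : 0 < ε) (hδ : 0 < δ)
    (hδ1 : δ ≤ 1) (h : ε < 1 / (20 + 8 * (n : ℝ)) ^ n * δ ^ n) :
    ε * n ≤ 1 ∧ 2 * (3 ^ (n - 1) - 1) / δ * (ε * n * (1 + 4 * (3 ^ (n - 1) - 1) / δ)) ≤ 1 / 8 := by
  have hn' : (1 : ℝ) ≤ n := by exact_mod_cast hn
  have hb : (1 : ℝ) ≤ 20 + 8 * n := by linarith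
  have hbpos : (0 : ℝ) < (20 + 8 * n) ^ n := by positivity
  have h1 : ε * (20 + 8 * (n : ℝ)) ^ n < δ ^ n := by
    rw [one_div, inv_mul_eq_div, lt_div_iff₀ hbpos] at h
    exact h
  constructor
  · have h2 : (20 + 8 * (n : ℝ)) ≤ (20 + 8 * n) ^ n := le_self_pow₀ hb (by omega)
    have h3 : δ ^ n ≤ 1 := pow_le_one₀ hδ.le hδ1
    nlinarith
  · obtain rfl | hn2 := hn.eq_or_lt
    · simp
    have hδ2 : δ ^ n ≤ δ ^ 2 := pow_le_pow_of_le_one hδ.le hδ1 hn2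
    set t : ℝ := 3 ^ (n - 1) with ht
    have ht1 : 1 ≤ t := one_le_pow₀ (by norm_num)
    have hpow : 64 * n * t ^ 2 ≤ (20 + 8 * (n : ℝ)) ^ n := by
      obtain ⟨m, rfl⟩ : ∃ m, n = m + 1 := ⟨n - 1, by omega⟩
      have hm : 1 ≤ m := by omega
      have ht2 : t ^ 2 = 9 ^ m := by
        rw [ht, Nat.add_sub_cancel, ← pow_mul, mul_comm, pow_mul]
        norm_num
      -- Since n ≥ 2, the base 20 + 8n is at least 36 = 4·9: the powers of 9 absorb t², those of 4
      -- help absorb 64n.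
      have h36 : (36 : ℝ) ^ m ≤ (20 + 8 * ((m + 1 : ℕ) : ℝ)) ^ m := by
        gcongr
        have : (1 : ℝ) ≤ m := by exact_mod_cast hm
        push_cast
        linarith
      have h4 : 64 * ((m + 1 : ℕ) : ℝ) ≤ 4 ^ m * (20 + 8 * ((m + 1 : ℕ) : ℝ)) := by
        obtain rfl | hm2 := hm.eq_or_lt
        · norm_num
        · have : (4 : ℝ) ^ 2 ≤ 4 ^ m := pow_le_pow_right₀ (by norm_num) hm2
          have hpos : (0 : ℝ) ≤ ((m + 1 : ℕ) : ℝ) := Nat.cast_nonneg _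
          nlinarith
      calc 64 * ((m + 1 : ℕ) : ℝ) * t ^ 2 = 64 * ((m + 1 : ℕ) : ℝ) * 9 ^ m := by rw [ht2]
        _ ≤ (4 ^ m * (20 + 8 * ((m + 1 : ℕ) : ℝ))) * 9 ^ m := by gcongr
        _ = 36 ^ m * (20 + 8 * ((m + 1 : ℕ) : ℝ)) := by
          rw [show (36 : ℝ) = 4 * 9 by norm_num, mul_pow]; ring
        _ ≤ (20 + 8 * ((m + 1 : ℕ) : ℝ)) ^ m * (20 + 8 * ((m + 1 : ℕ) : ℝ)) := by gcongr
        _ = _ := (pow_succ _ _).symm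
    have h2 : ε * (64 * n * t ^ 2) ≤ δ ^ 2 :=
      (mul_le_mul_of_nonneg_left hpow hε.le).trans (h1.le.trans hδ2)
    have h3 : 2 * (t - 1) / δ * (ε * n * (1 + 4 * (t - 1) / δ)) =
        (2 * (t - 1) * (ε * n) * (δ + 4 * (t - 1))) / δ ^ 2 := by
      field_simp
    rw [h3, div_le_iff₀ (by positivity)]
    have h4 : (t - 1) * (δ + 4 * (t - 1)) ≤ 4 * t ^ 2 := by nlinarith
    have h5 : 0 < ε * n := by positivity
    nlinarith

/-! ### Excluding eigenvalues outside the open unit disc -/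

/-- Quantitative exclusion of eigenvalues outside the open unit disc. -/
theorem eq_zero_of_eigen_outside {n : ℕ} {A B : Matrix (Fin n) (Fin n) ℝ} {π ρ : Fin n → ℝ}
    (hn : 1 ≤ n)
    (hArow : ∀ i, ∑ j, A i j = 1)
    (hπ : ∀ i, 0 < π i) (hπsum : ∑ i, π i = 1) (hπA : ∀ j, ∑ i, π i * A i j = π j)
    (hρ : ∀ i, 0 < ρ i) (hρsum : ∑ i, ρ i = 1) (hBρ : ∀ i, ∑ j, B i j * ρ j = ρ i)
    {C r ε : ℝ} (hC : 0 ≤ C) (hr0 : 0 ≤ r) (hr : r < 1) (hε : 0 < ε) (hεn : ε * n ≤ 1)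
    (hκ : 2 * C / (1 - r) * (ε * n * (1 + 4 * C / (1 - r))) ≤ 1 / 8)
    {l : ℂ} (hl : 1 ≤ ‖l‖)
    (hA : ∀ x : Fin n → ℂ, ∑ i, (π i : ℂ) * x i = 0 →
      ‖x‖ ≤ C / (‖l‖ - r) * ‖l • x - complexEnd A x‖)
    (hB : ∀ x : Fin n → ℂ, ∑ i, x i = 0 →
      ∑ i, ‖x i‖ ≤ C / (‖l‖ - r) * ∑ i, ‖(l • x - complexEnd B x) i‖)
    {x y : Fin n → ℂ} (hy : l • x - complexEnd A x = y)
    (hx : l • y - complexEnd B y = -((ε : ℂ) * (l - 1)) • x)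
    (hsum : ∑ i, y i = -(ε : ℂ) * ∑ i, x i) : x = 0 := by
  have : Nonempty (Fin n) := ⟨⟨0, hn⟩⟩
  have hn' : (1 : ℝ) ≤ n := by exact_mod_cast hn
  set δ := 1 - r with hδdef
  have hδ : 0 < δ := by linarith
  set d := ‖l‖ - r with hd
  have hδd : δ ≤ d := by linarith
  have hd0 : 0 < d := by linarith
  set X := ‖x‖ with hX
  have hX0 : 0 ≤ X := norm_nonneg x
  set σ := ∑ i, x i with hσ
  set c := ∑ i, (π i : ℂ) * x i with hc
  clear_value σ c
  have hσX : ‖σ‖ ≤ n * X := by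
    calc ‖σ‖ ≤ ∑ _i : Fin n, X := by
          rw [hσ]
          exact norm_sum_le_of_le _ fun i _ => norm_le_pi_norm x i
      _ = n * X := by simp
  have hl1 : ‖l - 1‖ ≤ ‖l‖ + 1 := by simpa using norm_sub_le l 1
  -- Both |l - 1|/d forms are used: this one bounds y uniformly in l, while the factor |l - 1| is
  -- retained in `hy'1` for the comparison near l = 1.
  have hl1d : ‖l - 1‖ / d ≤ 2 / δ := by
    rw [div_le_div_iff₀ hd0 hδ]
    nlinarith [norm_nonneg l]
  -- the component of `y` along the kernel of the sum functional
  set y' : Fin n → ℂ := fun i => y i + (ε : ℂ) * σ * ρ i with hy'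
  have hρsum' : ∑ i, (ρ i : ℂ) = 1 := by exact_mod_cast hρsum
  have hBρ' : ∀ i, ∑ j, (B i j : ℂ) * (ρ j : ℂ) = ρ i := fun i => by exact_mod_cast hBρ i
  have hy'sum : ∑ i, y' i = 0 := by
    simp only [hy', Finset.sum_add_distrib, ← Finset.mul_sum, hρsum', hsum]
    ring
  -- Uses (l - B)ρ = (l - 1)ρ, so the correction carries the same factor l - 1 as the right-hand
  -- side.
  have hBy' : ∀ i, (l • y' - complexEnd B y') i = -((ε : ℂ) * (l - 1)) * (x i - σ * ρ i) := by
    intro i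
    have h1 := congrFun hx i
    simp only [Pi.sub_apply, Pi.smul_apply, smul_eq_mul, complexEnd_apply] at h1 ⊢
    have h2 : ∑ j, (B i j : ℂ) * y' j = ∑ j, (B i j : ℂ) * y j + (ε : ℂ) * σ * ρ i := by
      simp only [hy', mul_add, Finset.sum_add_distrib]
      congr 1
      rw [← hBρ' i, Finset.mul_sum]
      exact Finset.sum_congr rfl fun j _ => by ring
    rw [h2, hy']
    linear_combination h1
  have hxσ : ∑ i, ‖x i - σ * ρ i‖ ≤ 2 * (n * X) := by
    calc ∑ i, ‖x i - σ * ρ i‖ ≤ ∑ i, (X + ‖σ‖ * ρ i) := by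
          refine Finset.sum_le_sum fun i _ => (norm_sub_le _ _).trans ?_
          rw [norm_mul, Complex.norm_real, Real.norm_of_nonneg (hρ i).le]
          gcongr
          exact norm_le_pi_norm x i
      _ = n * X + ‖σ‖ := by
          rw [Finset.sum_add_distrib, ← Finset.mul_sum, hρsum]
          simp
      _ ≤ _ := by linarith
  have hy'1 : ∑ i, ‖y' i‖ ≤ C * (2 * (ε * n) * X) * (‖l - 1‖ / d) := by
    calc ∑ i, ‖y' i‖ ≤ C / d * ∑ i, ‖(l • y' - complexEnd B y') i‖ := hB y' hy'sum
      _ = C / d * (ε * ‖l - 1‖ * ∑ i, ‖x i - σ * ρ i‖) := by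
          congr 1
          rw [Finset.mul_sum]
          refine Finset.sum_congr rfl fun i _ => ?_
          rw [hBy', norm_mul, norm_neg, norm_mul, Complex.norm_real, Real.norm_of_nonneg hε.le]
      _ ≤ C / d * (ε * ‖l - 1‖ * (2 * (n * X))) := by gcongr
      _ = _ := by ring
  have hyX : ‖y‖ ≤ ε * n * (1 + 4 * C / δ) * X := by
    have h1 : ∑ i, ‖y' i‖ ≤ C * (2 * (ε * n) * X) * (2 / δ) := hy'1.trans (by gcongr)
    rw [pi_norm_le_iff_of_nonneg (by positivity)]
    intro i
    have h2 : y i = y' i - (ε : ℂ) * σ * ρ i := by simp [hy']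
    have h3 : ‖y' i‖ ≤ ∑ i, ‖y' i‖ :=
      Finset.single_le_sum (f := fun i => ‖y' i‖) (fun i _ => norm_nonneg _) (Finset.mem_univ i)
    have hρ1 : ρ i ≤ 1 := by
      rw [← hρsum]
      exact Finset.single_le_sum (f := ρ) (fun i _ => (hρ i).le) (Finset.mem_univ i)
    have h4 : ‖(ε : ℂ) * σ * ρ i‖ ≤ ε * (n * X) := by
      rw [norm_mul, norm_mul, Complex.norm_real, Complex.norm_real, Real.norm_of_nonneg hε.le,
        Real.norm_of_nonneg (hρ i).le]
      calc ε * ‖σ‖ * ρ i ≤ ε * ‖σ‖ * 1 := by gcongr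
        _ ≤ ε * (n * X) := by rw [mul_one]; gcongr
    calc ‖y i‖ ≤ ‖y' i‖ + ‖(ε : ℂ) * σ * ρ i‖ := by rw [h2]; exact norm_sub_le _ _
      _ ≤ C * (2 * (ε * n) * X) * (2 / δ) + ε * (n * X) := by linarith
      _ = _ := by ring
  -- the component of `x` along the kernel of the weighted sum
  have hπsum' : ∑ i, (π i : ℂ) = 1 := by exact_mod_cast hπsum
  have hπA' : ∀ j, ∑ i, (π i : ℂ) * (A i j : ℂ) = π j := fun j => by exact_mod_cast hπA j
  have hArow' : ∀ i, ∑ j, (A i j : ℂ) = 1 := fun i => by exact_mod_cast hArow i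
  have hπy : ∑ i, (π i : ℂ) * y i = (l - 1) * c := by
    have h1 : ∑ i, (π i : ℂ) * ∑ j, (A i j : ℂ) * x j = c := by
      simp only [Finset.mul_sum, ← mul_assoc]
      rw [Finset.sum_comm]
      simp only [← Finset.sum_mul, hπA', hc]
    rw [← hy]
    simp only [Pi.sub_apply, Pi.smul_apply, smul_eq_mul, complexEnd_apply, mul_sub,
      Finset.sum_sub_distrib, h1]
    rw [sub_mul, one_mul, hc, Finset.mul_sum]
    congr 1
    exact Finset.sum_congr rfl fun i _ => by ring
  have hweight : ∀ (u : Fin n → ℂ) (K : ℝ), (∀ i, ‖u i‖ ≤ K) → ‖∑ i, (π i : ℂ) * u i‖ ≤ K := by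
    intro u K hu
    calc ‖∑ i, (π i : ℂ) * u i‖ ≤ ∑ i, π i * K := by
          refine norm_sum_le_of_le _ fun i _ => ?_
          rw [norm_mul, Complex.norm_real, Real.norm_of_nonneg (hπ i).le]
          exact mul_le_mul_of_nonneg_left (hu i) (hπ i).le
      _ = K := by rw [← Finset.sum_mul, hπsum, one_mul]
  set x' : Fin n → ℂ := fun i => x i - c with hx'
  have hx'sum : ∑ i, (π i : ℂ) * x' i = 0 := by
    simp only [hx', mul_sub, Finset.sum_sub_distrib, ← Finset.sum_mul, hπsum']
    rw [one_mul, ← hc, sub_self]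
  have hAx' : ‖l • x' - complexEnd A x'‖ ≤ 2 * ‖y‖ := by
    rw [pi_norm_le_iff_of_nonneg (by positivity)]
    intro i
    have h1 : (l • x' - complexEnd A x') i = y i - ∑ i, (π i : ℂ) * y i := by
      rw [hπy, ← hy]
      simp only [Pi.sub_apply, Pi.smul_apply, smul_eq_mul, complexEnd_apply, hx', mul_sub,
        Finset.sum_sub_distrib, ← Finset.sum_mul, hArow']
      ring
    rw [h1, two_mul]
    exact (norm_sub_le _ _).trans
      (add_le_add (norm_le_pi_norm y i) (hweight y _ fun i => norm_le_pi_norm y i))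
  set κ := 2 * C / δ * (ε * n * (1 + 4 * C / δ)) with hκdef
  -- The eigenvector component x is nearly the constant c, so c controls all of x.
  have hx'X : ‖x'‖ ≤ 1 / 8 * X := by
    calc ‖x'‖ ≤ C / d * ‖l • x' - complexEnd A x'‖ := hA x' hx'sum
      _ ≤ C / δ * (2 * (ε * n * (1 + 4 * C / δ) * X)) := by
          gcongr
          exact hAx'.trans (by linarith)
      _ = κ * X := by rw [hκdef]; ring
      _ ≤ _ := by gcongr
  have hXc : X ≤ 8 / 7 * ‖c‖ := by
    have : X ≤ ‖c‖ + 1 / 8 * X := by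
      rw [hX, pi_norm_le_iff_of_nonneg (by positivity)]
      intro i
      have h1 : x i = c + x' i := by simp [hx']
      rw [h1]
      exact (norm_add_le _ _).trans (by gcongr; exact (norm_le_pi_norm x' i).trans hx'X)
    linarith
  by_contra hx0
  have hXpos : 0 < X := norm_pos_iff.2 hx0
  have hcpos : 0 < ‖c‖ := by linarith
  set s := ∑ i, π i * ρ i with hs
  have hspos : 0 < s := Finset.sum_pos (fun i _ => mul_pos (hπ i) (hρ i)) Finset.univ_nonempty
  have hs1 : s ≤ 1 := by
    rw [← hπsum]
    refine Finset.sum_le_sum fun i _ => ?_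
    have hρ1 : ρ i ≤ 1 := by
      rw [← hρsum]
      exact Finset.single_le_sum (f := ρ) (fun i _ => (hρ i).le) (Finset.mem_univ i)
    nlinarith [hπ i]
  have hπy' : ∑ i, (π i : ℂ) * y' i = (l - 1) * c + (ε : ℂ) * s * σ := by
    simp only [hy', mul_add, Finset.sum_add_distrib, hπy, hs]
    congr 1
    push_cast
    rw [Finset.mul_sum, Finset.sum_mul]
    exact Finset.sum_congr rfl fun i _ => by ring
  -- Pairing y' with π: since y' is small compared with |l - 1|, so is (l - 1)c + εsσ, where σ is
  -- close to nc.
  have h1 : ‖(l - 1) * c + (ε : ℂ) * s * σ‖ ≤ 1 / 7 * (‖l - 1‖ * ‖c‖) := by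
    rw [← hπy']
    have h2 : ∀ i, ‖y' i‖ ≤ C * (2 * (ε * n) * X) * (‖l - 1‖ / d) := fun i =>
      (Finset.single_le_sum (f := fun i => ‖y' i‖) (fun i _ => norm_nonneg _)
        (Finset.mem_univ i)).trans hy'1
    refine (hweight y' _ h2).trans ?_
    have h3 : 2 * C / δ * (ε * n) ≤ 1 / 8 := by
      refine le_trans ?_ hκ
      have : ε * n * 1 ≤ ε * n * (1 + 4 * C / δ) := by
        gcongr
        have : 0 ≤ 4 * C / δ := by positivity
        linarith
      rw [mul_one] at this
      rw [hκdef]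
      gcongr
    calc C * (2 * (ε * n) * X) * (‖l - 1‖ / d) ≤ C * (2 * (ε * n) * X) * (‖l - 1‖ / δ) := by
          gcongr
      _ = 2 * C / δ * (ε * n) * (‖l - 1‖ * X) := by ring
      _ ≤ 1 / 8 * (‖l - 1‖ * (8 / 7 * ‖c‖)) := by gcongr
      _ = _ := by ring
  have h2 : ‖σ - n * c‖ ≤ n * (1 / 7 * ‖c‖) := by
    have h3 : σ - n * c = ∑ i, x' i := by simp [hx', hσ]
    rw [h3]
    calc ‖∑ i, x' i‖ ≤ ∑ _i : Fin n, 1 / 8 * X :=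
          norm_sum_le_of_le _ fun i _ => (norm_le_pi_norm x' i).trans hx'X
      _ = n * (1 / 8 * X) := by simp
      _ ≤ _ := by
        gcongr ?_ * ?_
        linarith
  -- To first order the perturbed eigenvalue is 1 - t.
  set t := ε * n * s with ht
  have htpos : 0 < t := by positivity
  have ht1 : t ≤ 1 := by
    have : ε * n * s ≤ 1 * 1 := mul_le_mul hεn hs1 hspos.le zero_le_one
    linarith
  have h3 : ‖(l - 1) + t‖ * ‖c‖ ≤ 1 / 7 * (‖l - 1‖ + t) * ‖c‖ := by
    have e : ((l - 1) + t) * c =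
        ((l - 1) * c + (ε : ℂ) * s * σ) - (ε : ℂ) * s * (σ - n * c) := by
      rw [ht]; push_cast; ring
    have h4 : ‖(ε : ℂ) * s * (σ - n * c)‖ ≤ 1 / 7 * t * ‖c‖ := by
      rw [norm_mul, norm_mul, Complex.norm_real, Complex.norm_real, Real.norm_of_nonneg hε.le,
        Real.norm_of_nonneg hspos.le]
      calc ε * s * ‖σ - n * c‖ ≤ ε * s * (n * (1 / 7 * ‖c‖)) := by gcongr
        _ = _ := by rw [ht]; ring
    rw [← norm_mul, e]
    refine (norm_sub_le _ _).trans ?_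
    linarith
  have h4 : ‖(l - 1) + t‖ ≤ 1 / 7 * (‖l - 1‖ + t) := le_of_mul_le_mul_right h3 hcpos
  have h5 : ‖l - 1‖ ≤ ‖(l - 1) + t‖ + t := by
    have := norm_sub_le ((l - 1) + t) (t : ℂ)
    rwa [add_sub_cancel_right, Complex.norm_real, Real.norm_of_nonneg htpos.le] at this
  have h6 : ‖l‖ ≤ ‖(l - 1) + t‖ + (1 - t) := by
    have := norm_add_le ((l - 1) + t) ((1 - t : ℝ) : ℂ)
    rw [Complex.norm_real, Real.norm_of_nonneg (by linarith)] at this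
    have e : l - 1 + (t : ℂ) + ((1 - t : ℝ) : ℂ) = l := by push_cast; ring
    rwa [e] at this
  -- From `h4` and `h5`, |l - 1 + t| ≤ t/3; then `h6` gives |l| ≤ 1 - 2t/3 < 1.
  linarith

/-! ### Geometric decay of matrix powers -/

section PowerBound

attribute [local instance] Matrix.linftyOpNormedRing Matrix.linftyOpNormedAlgebra

theorem norm_entry_le_linftyOpNorm {m : Type*} [Fintype m] [DecidableEq m] (P : Matrix m m ℂ)
    (i j : m) : ‖P i j‖ ≤ ‖P‖ := by
  rw [linfty_opNorm_def]
  have h1 : ‖P i j‖₊ ≤ ∑ j, ‖P i j‖₊ :=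
    Finset.single_le_sum (f := fun j => ‖P i j‖₊) (fun _ _ => zero_le) (Finset.mem_univ j)
  have h2 := Finset.le_sup (f := fun i => ∑ j, ‖P i j‖₊) (Finset.mem_univ i)
  exact_mod_cast h1.trans h2

/-- Powers of a real matrix whose complex eigenvalues lie in the open unit disc decay
geometrically. -/
theorem exists_geometric_bound {m : Type*} [Fintype m] [DecidableEq m] [Nonempty m]
    (P : Matrix m m ℝ) (h : ∀ (l : ℂ) (v : m → ℂ), 1 ≤ ‖l‖ → complexEnd P v = l • v → v = 0) :
    ∃ K γ : ℝ, 0 ≤ K ∧ 0 < γ ∧ γ < 1 ∧ ∀ k i j, |(P ^ k) i j| ≤ K * γ ^ k := by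
  set a : Matrix m m ℂ := P.map (algebraMap ℝ ℂ) with ha
  have : CompleteSpace (Matrix m m ℂ) := FiniteDimensional.complete ℂ _
  obtain ⟨l, hl, hlr⟩ := spectrum.exists_nnnorm_eq_spectralRadius a
  have hl1 : ‖l‖ < 1 := by
    by_contra hcon
    rw [← Matrix.spectrum_toLin', ← Module.End.hasEigenvalue_iff_mem_spectrum] at hl
    obtain ⟨v, hv⟩ := hl.exists_hasEigenvector
    exact hv.2 (h l v (not_lt.1 hcon) hv.apply_eq_smul)
  obtain ⟨γ, hγl, hγ1⟩ := exists_between hl1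
  have hγ0 : 0 < γ := (norm_nonneg l).trans_lt hγl
  have hlim := spectrum.pow_norm_pow_one_div_tendsto_nhds_spectralRadius a
  -- Gelfand's formula: ‖a^k‖^(1/k) is eventually below γ. The finitely many earlier powers are
  -- absorbed in K.
  have hlt : spectralRadius ℂ a < ENNReal.ofReal γ := by
    rw [← hlr, ← ENNReal.ofReal_coe_nnreal, ENNReal.ofReal_lt_ofReal_iff hγ0]
    exact hγl
  obtain ⟨k₀, hk₀⟩ := eventually_atTop.1 (hlim.eventually (gt_mem_nhds hlt))
  have hbig : ∀ k, k₀ + 1 ≤ k → ‖a ^ k‖ ≤ γ ^ k := by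
    intro k hk
    have h1 := (ENNReal.ofReal_lt_ofReal_iff hγ0).1 (hk₀ k (by omega))
    have hk0 : (k : ℝ) ≠ 0 := by
      have : k ≠ 0 := by omega
      exact_mod_cast this
    calc ‖a ^ k‖ = (‖a ^ k‖ ^ (1 / (k : ℝ))) ^ k := by
          rw [← Real.rpow_natCast, ← Real.rpow_mul (norm_nonneg _), one_div,
            inv_mul_cancel₀ hk0, Real.rpow_one]
      _ ≤ γ ^ k := by gcongr
  set K : ℝ := 1 + ∑ k ∈ Finset.range (k₀ + 1), ‖a ^ k‖ / γ ^ k with hK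
  have hsum0 : 0 ≤ ∑ k ∈ Finset.range (k₀ + 1), ‖a ^ k‖ / γ ^ k :=
    Finset.sum_nonneg fun k _ => by positivity
  refine ⟨K, γ, by linarith, hγ0, hγ1, fun k i j => ?_⟩
  have hentry : |(P ^ k) i j| ≤ ‖a ^ k‖ := by
    have h1 : a ^ k = (P ^ k).map (algebraMap ℝ ℂ) := by
      rw [ha]
      exact (map_pow (algebraMap ℝ ℂ).mapMatrix P k).symm
    have h2 := norm_entry_le_linftyOpNorm (a ^ k) i j
    rw [h1, map_apply] at h2
    rw [h1]
    simpa using h2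
  refine hentry.trans ?_
  have hγk : 0 < γ ^ k := pow_pos hγ0 k
  by_cases hk : k₀ + 1 ≤ k
  · calc ‖a ^ k‖ ≤ 1 * γ ^ k := by rw [one_mul]; exact hbig k hk
      _ ≤ K * γ ^ k := by gcongr; linarith
  · have h1 : ‖a ^ k‖ / γ ^ k ≤ ∑ k ∈ Finset.range (k₀ + 1), ‖a ^ k‖ / γ ^ k :=
      Finset.single_le_sum (f := fun k => ‖a ^ k‖ / γ ^ k) (fun k _ => by positivity)
        (Finset.mem_range.2 (by omega))
    rw [← div_le_iff₀ hγk]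
    linarith

end PowerBound

/-- The limit of the powers of the weight matrix. -/
noncomputable def limitMatrix (n : ℕ) : Matrix (Fin n ⊕ Fin n) (Fin n ⊕ Fin n) ℝ :=
  Matrix.of fun i _ => Sum.elim (fun _ => 1 / (n : ℝ)) (fun _ => 0) i

theorem weightMatrix_col_sum {n : ℕ} {A B : Matrix (Fin n) (Fin n) ℝ}
    (hB : ∀ j, ∑ i, B i j = 1) (ε : ℝ) (j : Fin n ⊕ Fin n) :
    ∑ i, weightMatrix A B ε i j = 1 := by
  rcases j with j | j
  · simp [weightMatrix, Fintype.sum_sum_type, Matrix.one_apply]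
  · simp [weightMatrix, Fintype.sum_sum_type, Matrix.one_apply, hB]

theorem limitMatrix_mul {n : ℕ} {P : Matrix (Fin n ⊕ Fin n) (Fin n ⊕ Fin n) ℝ}
    (hP : ∀ j, ∑ i, P i j = 1) : limitMatrix n * P = limitMatrix n := by
  ext i j
  simp only [mul_apply, limitMatrix, of_apply]
  rw [← Finset.mul_sum, hP, mul_one]

theorem limitMatrix_col_sum {n : ℕ} (hn : 1 ≤ n) (j : Fin n ⊕ Fin n) :
    ∑ i, limitMatrix n i j = 1 := by
  have : (n : ℝ) ≠ 0 := by
    have : n ≠ 0 := by omega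
    exact_mod_cast this
  simp [limitMatrix, Fintype.sum_sum_type, this]

theorem weightMatrix_mul_limitMatrix {n : ℕ} {A B : Matrix (Fin n) (Fin n) ℝ}
    (hA : ∀ i, ∑ j, A i j = 1) (ε : ℝ) :
    weightMatrix A B ε * limitMatrix n = limitMatrix n := by
  ext i j
  rcases i with i | i
  · simp only [mul_apply, limitMatrix, of_apply, Fintype.sum_sum_type, weightMatrix,
      fromBlocks_apply₁₁, Sum.elim_inl, Sum.elim_inr, mul_zero, Finset.sum_const_zero, add_zero]
    rw [← Finset.sum_mul, hA, one_mul]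
  · simp only [mul_apply, limitMatrix, of_apply, Fintype.sum_sum_type, weightMatrix,
      fromBlocks_apply₂₁, Sum.elim_inl, Sum.elim_inr, mul_zero, Finset.sum_const_zero, add_zero]
    rw [← Finset.sum_mul]
    simp [hA, Matrix.one_apply]

/-- Supplies the Perron vectors and resolvent bounds for A and B. The second eigenvector block is
rescaled by ε, which removes it from the first block equation. -/
theorem eq_zero_of_weightMatrix_eigen {n : ℕ} (hn : 1 ≤ n) {G : Digraph (Fin n)}
    (hG : StronglyConnected G) {A B : Matrix (Fin n) (Fin n) ℝ} (hA : IsRowWeight G A)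
    (hB : IsColWeight G B) {ε : ℝ} (hε : 0 < ε) (hε' : ε < epsBound A B) {l : ℂ} (hl : 1 ≤ ‖l‖)
    {v : Fin n ⊕ Fin n → ℂ} (hv : complexEnd (weightMatrix A B ε) v = l • v)
    (hsum : ∑ i, v i = 0) : v = 0 := by
  have hA0 : ∀ i j, 0 ≤ A i j := fun i j => by
    by_cases h : j ∈ inNeighbors G i
    exacts [(hA.pos i j h).le, (hA.zero i j h).ge]
  have hB0 : ∀ i j, 0 ≤ B i j := fun i j => by
    by_cases h : i ∈ outNeighbors G j
    exacts [(hB.pos i j h).le, (hB.zero i j h).ge]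
  obtain ⟨π, hπ, hπsum, hπA⟩ := exists_perron_vector (P := Aᵀ) (R := Function.swap G.Adj) hn
    (fun i j => hA0 j i) (fun j => hA.row_sum j) (fun i j h => hA.pos j i h)
    (fun i j => Relation.reflTransGen_swap.2 (hG j i))
  obtain ⟨ρ, hρ, hρsum, hBρ⟩ := exists_perron_vector (P := B) (R := G.Adj) hn
    hB0 hB.col_sum (fun i j h => hB.pos i j h) hG
  obtain ⟨s, hs, hs1, hsb⟩ := rowStochastic_resolvent_bound (P := A) (R := G.Adj) hn
    hA0 hA.row_sum (fun i j h => hA.pos i j h) hG hπ hπA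
  obtain ⟨t, ht, ht1, htb⟩ := colStochastic_resolvent_bound (P := B) (R := G.Adj) hn
    hB0 hB.col_sum (fun i j h => hB.pos i j h) hG
  obtain ⟨hr0, hr1, hsr, htr⟩ := absLambdaThree_spec hs ht hs1 ht1
  set r := absLambdaThree A B
  -- If |λ₃| were 1, the bound Υ would be 0 (as n ≥ 1), contradicting 0 < ε < Υ.
  have hr : r < 1 := by
    refine lt_of_le_of_ne hr1 fun h => ?_
    have h0 : epsBound A B = 0 := by
      have : n ≠ 0 := by omega
      change 1 / (20 + 8 * (n : ℝ)) ^ n * (1 - r) ^ n = 0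
      rw [h, sub_self, zero_pow this, mul_zero]
    linarith
  obtain ⟨hεn, hκ⟩ := small_of_lt_bound hn hε (sub_pos.2 hr) (by linarith) hε'
  have hC : (0 : ℝ) ≤ 3 ^ (n - 1) - 1 := sub_nonneg.2 (one_le_pow₀ (by norm_num))
  have hv1 : ∀ i, ∑ j, (A i j : ℂ) * v (Sum.inl j) + ε * v (Sum.inr i) = l * v (Sum.inl i) := by
    intro i
    have := congrFun hv (Sum.inl i)
    rw [complexEnd_apply] at this
    simpa [Fintype.sum_sum_type, weightMatrix, Matrix.one_apply, apply_ite Complex.ofReal] using this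
  have hv2 : ∀ i, v (Sum.inl i) - ∑ j, (A i j : ℂ) * v (Sum.inl j) +
      (∑ j, (B i j : ℂ) * v (Sum.inr j) - ε * v (Sum.inr i)) = l * v (Sum.inr i) := by
    intro i
    have := congrFun hv (Sum.inr i)
    rw [complexEnd_apply] at this
    simpa [Fintype.sum_sum_type, weightMatrix, Matrix.one_apply, sub_mul,
      apply_ite Complex.ofReal, Finset.sum_sub_distrib] using this
  rw [Fintype.sum_sum_type] at hsum
  have hεc : (ε : ℂ) ≠ 0 := by exact_mod_cast hε.ne'
  have hx := eq_zero_of_eigen_outside (A := A) (B := B) hn hA.row_sum hπ hπsum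
    (fun j => by
      have := congrFun hπA j
      simp only [mulVec, dotProduct, transpose_apply] at this
      rw [← this]
      exact Finset.sum_congr rfl fun i _ => mul_comm _ _)
    hρ hρsum (fun i => congrFun hBρ i) hC hr0 hr hε hεn hκ hl (hsb r hr hsr l hl)
    (htb r hr htr l hl) (x := fun i => v (Sum.inl i)) (y := fun i => ε * v (Sum.inr i))
    (by
      funext i
      simp only [Pi.sub_apply, Pi.smul_apply, smul_eq_mul, complexEnd_apply]
      linear_combination -(hv1 i))
    (by
      funext i
      have h1 : ∑ j, (B i j : ℂ) * (ε * v (Sum.inr j)) = ε * ∑ j, (B i j : ℂ) * v (Sum.inr j) := by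
        rw [Finset.mul_sum]
        exact Finset.sum_congr rfl fun j _ => by ring
      simp only [Pi.sub_apply, Pi.smul_apply, smul_eq_mul, complexEnd_apply, h1]
      linear_combination -(ε : ℂ) * (hv1 i) - (ε : ℂ) * hv2 i)
    (by
      rw [← Finset.mul_sum]
      linear_combination (ε : ℂ) * hsum)
  funext i
  rcases i with i | i
  · exact congrFun hx i
  · have h1 := hv1 i
    have h2 : ∀ j, v (Sum.inl j) = 0 := fun j => congrFun hx j
    simpa [h2, hεc] using h1

/-- Both M and L have column sums 1, so M - L maps into sum-zero vectors. An eigenvector of M - L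
for l ≠ 0 thus has sum zero, is killed by L, and is an eigenvector of M. -/
theorem exists_geometric_bound_weightMatrix {n : ℕ} (hn : 1 ≤ n) {G : Digraph (Fin n)}
    (hG : StronglyConnected G) {A B : Matrix (Fin n) (Fin n) ℝ} (hA : IsRowWeight G A)
    (hB : IsColWeight G B) {ε : ℝ} (hε : 0 < ε) (hε' : ε < epsBound A B) :
    ∃ K γ : ℝ, 0 ≤ K ∧ 0 < γ ∧ γ < 1 ∧
      ∀ k i j, |((weightMatrix A B ε - limitMatrix n) ^ k) i j| ≤ K * γ ^ k := by
  have : Nonempty (Fin n ⊕ Fin n) := ⟨Sum.inl ⟨0, hn⟩⟩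
  refine exists_geometric_bound _ fun l v hl hv => ?_
  have hl0 : l ≠ 0 := by
    rintro rfl
    norm_num at hl
  have hsub : ∀ i, ∑ j, (weightMatrix A B ε i j : ℂ) * v j =
      l * v i + ∑ j, (limitMatrix n i j : ℂ) * v j := by
    intro i
    have h1 := congrFun hv i
    rw [complexEnd_apply] at h1
    simp only [Matrix.sub_apply, Complex.ofReal_sub, sub_mul, Finset.sum_sub_distrib, Pi.smul_apply,
      smul_eq_mul] at h1
    linear_combination h1
  have hcol : ∀ (Q : Matrix (Fin n ⊕ Fin n) (Fin n ⊕ Fin n) ℝ), (∀ j, ∑ i, Q i j = 1) →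
      ∑ i, ∑ j, (Q i j : ℂ) * v j = ∑ j, v j := by
    intro Q hQ
    rw [Finset.sum_comm]
    refine Finset.sum_congr rfl fun j _ => ?_
    rw [← Finset.sum_mul, ← Complex.ofReal_sum, hQ, Complex.ofReal_one, one_mul]
  have hsum : ∑ i, v i = 0 := by
    have h1 := Finset.sum_congr rfl fun i (_ : i ∈ Finset.univ) => hsub i
    rw [hcol _ (weightMatrix_col_sum hB.col_sum ε), Finset.sum_add_distrib,
      hcol _ (limitMatrix_col_sum hn), ← Finset.mul_sum] at h1
    have h2 : l * ∑ i, v i = 0 := by linear_combination -h1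
    exact (mul_eq_zero.1 h2).resolve_left hl0
  refine eq_zero_of_weightMatrix_eigen hn hG hA hB hε hε' hl (funext fun i => ?_) hsum
  rw [complexEnd_apply, hsub i]
  have : ∑ j, (limitMatrix n i j : ℂ) * v j = 0 := by
    simp only [limitMatrix, of_apply]
    rw [← Finset.mul_sum, hsum, mul_zero]
  rw [this, add_zero]
  rfl

/-! ### Scalar sequences -/

theorem summable_sq_of_recurrence {γ c : ℝ} (hγ0 : 0 < γ) (hγ1 : γ < 1) {α u : ℕ → ℝ}
    (hα : Summable fun k => α k ^ 2) (hu : ∀ k, u (k + 1) = γ * u k + c * α k) :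
    Summable fun k => u k ^ 2 := by
  have hγ' : 0 < 1 - γ := by linarith
  have hstep : ∀ k, u (k + 1) ^ 2 ≤ γ * u k ^ 2 + c ^ 2 / (1 - γ) * α k ^ 2 := by
    intro k
    rw [hu]
    -- Writes u_{k+1} as the convex combination γu_k + (1 - γ)w, so that convexity of the square
    -- applies.
    set w := c * α k / (1 - γ) with hw
    have h1 : c * α k = (1 - γ) * w := by rw [hw]; field_simp
    have h2 : c ^ 2 / (1 - γ) * α k ^ 2 = (1 - γ) * w ^ 2 := by rw [hw]; field_simp
    rw [h1, h2]
    nlinarith [mul_nonneg (mul_nonneg hγ0.le hγ'.le) (sq_nonneg (u k - w))]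
  set S := ∑' k, c ^ 2 / (1 - γ) * α k ^ 2 with hS
  have hsum : Summable fun k => c ^ 2 / (1 - γ) * α k ^ 2 := hα.mul_left _
  refine summable_of_sum_range_le (c := (u 0 ^ 2 + S) / (1 - γ)) (fun k => sq_nonneg _) fun K => ?_
  have h1 : ∑ k ∈ Finset.range K, u (k + 1) ^ 2 ≤ γ * ∑ k ∈ Finset.range K, u k ^ 2 + S := by
    calc ∑ k ∈ Finset.range K, u (k + 1) ^ 2
        ≤ ∑ k ∈ Finset.range K, (γ * u k ^ 2 + c ^ 2 / (1 - γ) * α k ^ 2) :=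
          Finset.sum_le_sum fun k _ => hstep k
      _ = γ * ∑ k ∈ Finset.range K, u k ^ 2 +
            ∑ k ∈ Finset.range K, c ^ 2 / (1 - γ) * α k ^ 2 := by
          rw [Finset.sum_add_distrib, ← Finset.mul_sum]
      _ ≤ _ := by
          gcongr
          exact hsum.sum_le_tsum _ fun k _ => by positivity
  have h2 : ∑ k ∈ Finset.range K, u k ^ 2 ≤ ∑ k ∈ Finset.range K, u (k + 1) ^ 2 + u 0 ^ 2 := by
    have := Finset.sum_range_succ' (fun k => u k ^ 2) K
    rw [← this, Finset.sum_range_succ]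
    exact le_add_of_nonneg_right (sq_nonneg _)
  rw [le_div_iff₀ hγ']
  linarith

/-- Deterministic Robbins–Siegmund lemma. -/
theorem tendsto_and_summable_of_quasi_descent {a b c : ℕ → ℝ} (ha : ∀ k, 0 ≤ a k)
    (hb : ∀ k, 0 ≤ b k) (hc : ∀ k, 0 ≤ c k) (hcs : Summable c)
    (h : ∀ k, a (k + 1) ≤ a k - b k + c k) :
    (∃ L, Tendsto a atTop (𝓝 L)) ∧ Summable b := by
  set s : ℕ → ℝ := fun K => ∑ k ∈ Finset.range K, c k with hs
  have hsle : ∀ K, s K ≤ ∑' k, c k := fun K => hcs.sum_le_tsum _ fun k _ => hc k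
  have htel : ∀ K, a K + ∑ k ∈ Finset.range K, b k ≤ a 0 + s K := by
    intro K
    induction K with
    | zero => simp [hs]
    | succ K ih =>
      simp only [hs, Finset.sum_range_succ] at ih ⊢
      linarith [h K]
  constructor
  · have hanti : Antitone fun K => a K - s K := antitone_nat_of_succ_le fun K => by
      simp only [hs, Finset.sum_range_succ]
      linarith [h K, hb K]
    have hbdd : BddBelow (Set.range fun K => a K - s K) := by
      refine ⟨-∑' k, c k, ?_⟩
      rintro _ ⟨K, rfl⟩
      simp only
      linarith [ha K, hsle K]
    have h1 := tendsto_atTop_ciInf hanti hbdd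
    have h2 : Tendsto s atTop (𝓝 (∑' k, c k)) := hcs.hasSum.tendsto_sum_nat
    exact ⟨_, by simpa using h1.add h2⟩
  · refine summable_of_sum_range_le (c := a 0 + ∑' k, c k) hb fun K => ?_
    linarith [htel K, ha K, hsle K]

theorem frequently_lt_of_summable_mul {α φ : ℕ → ℝ} (hα : ∀ k, 0 ≤ α k)
    (hdiv : Tendsto (fun K => ∑ k ∈ Finset.range K, α k) atTop atTop)
    (hsum : Summable fun k => α k * φ k) {δ : ℝ} (hδ : 0 < δ) : ∃ᶠ k in atTop, φ k < δ := by
  intro hcon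
  have hev : ∀ᶠ k in atTop, ‖α k‖ ≤ δ⁻¹ * (α k * φ k) := by
    filter_upwards [hcon] with k hk
    rw [Real.norm_of_nonneg (hα k), inv_mul_eq_div, le_div_iff₀ hδ]
    exact mul_le_mul_of_nonneg_left (not_lt.1 hk) (hα k)
  have hs : Summable α := Summable.of_norm_bounded_eventually_nat (hsum.mul_left _) hev
  exact not_tendsto_nhds_of_tendsto_atTop hdiv _ hs.hasSum.tendsto_sum_nat

/-! ### Subgradients and quasi-Fejér convergence -/

/-- A hyperplane separates the open strict epigraph from (x, f x). Its vertical coefficient m is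
negative, as the epigraph contains points right above (x, f x), so its slope is a subgradient. -/
theorem exists_isSubgradientAt {p : ℕ} {f : EuclideanSpace ℝ (Fin p) → ℝ}
    (hf : ConvexOn ℝ Set.univ f) (x : EuclideanSpace ℝ (Fin p)) :
    ∃ g, IsSubgradientAt f g x := by
  have hcont : Continuous f := hf.locallyLipschitz.continuous
  have hopen : IsOpen {q : EuclideanSpace ℝ (Fin p) × ℝ | q.1 ∈ Set.univ ∧ f q.1 < q.2} := by
    simp only [Set.mem_univ, true_and]
    exact isOpen_lt (hcont.comp continuous_fst) continuous_snd
  obtain ⟨F, hF⟩ := geometric_hahn_banach_open_point hf.convex_strict_epigraph hopen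
    (x := (x, f x)) (by simp)
  set φ : EuclideanSpace ℝ (Fin p) →L[ℝ] ℝ := F.comp (ContinuousLinearMap.inl ℝ _ _) with hφ
  set m : ℝ := F (0, 1) with hm
  have hdecomp : ∀ y t, F (y, t) = φ y + t * m := by
    intro y t
    have : ((y, t) : EuclideanSpace ℝ (Fin p) × ℝ) = (y, 0) + t • (0, 1) := by simp
    rw [this, map_add, map_smul]
    rfl
  have hstrict : ∀ y t, f y < t → φ y + t * m < φ x + f x * m := by
    intro y t hyt
    have := hF (y, t) ⟨Set.mem_univ _, hyt⟩
    rwa [hdecomp, hdecomp] at this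
  have hmneg : m < 0 := by
    have := hstrict x (f x + 1) (by linarith)
    linarith
  have hle : ∀ y, φ y + f y * m ≤ φ x + f x * m := by
    intro y
    refine le_of_forall_pos_le_add fun η hη => ?_
    have := hstrict y (f y + η / (-m)) (by
      have : 0 < η / (-m) := div_pos hη (neg_pos.2 hmneg)
      linarith)
    have e : η / (-m) * m = -η := by
      have := hmneg.ne
      field_simp
    rw [add_mul, e] at this
    linarith
  refine ⟨(-m)⁻¹ • (InnerProductSpace.toDual ℝ _).symm φ, fun y => ?_⟩
  rw [inner_smul_left, InnerProductSpace.toDual_symm_apply, map_sub]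
  have h1 := hle y
  have hm' : 0 < -m := neg_pos.2 hmneg
  simp only [conj_trivial]
  rw [← le_sub_iff_add_le', inv_mul_le_iff₀ hm']
  linarith

/-- Convergence of an inexact subgradient method from a quasi-Fejér inequality. -/
theorem exists_tendsto_of_quasi_fejer {p : ℕ} {F : EuclideanSpace ℝ (Fin p) → ℝ}
    (hF : Continuous F) {xstar : EuclideanSpace ℝ (Fin p)} (hmin : ∀ y, F xstar ≤ F y)
    {α c : ℕ → ℝ} (hα : ∀ k, 0 ≤ α k)
    (hdiv : Tendsto (fun K => ∑ k ∈ Finset.range K, α k) atTop atTop)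
    (hc : ∀ k, 0 ≤ c k) (hcs : Summable c) {τ : ℝ} (hτ : 0 < τ)
    {x : ℕ → EuclideanSpace ℝ (Fin p)}
    (h : ∀ y k, ‖x (k + 1) - y‖ ^ 2 ≤ ‖x k - y‖ ^ 2 - τ * (α k * (F (x k) - F y)) + c k) :
    ∃ w, Tendsto x atTop (𝓝 w) := by
  have hmain : ∀ y, (∀ v, F y ≤ F v) →
      (∃ L, Tendsto (fun k => ‖x k - y‖ ^ 2) atTop (𝓝 L)) ∧
        Summable fun k => τ * (α k * (F (x k) - F y)) := fun y hy =>
    tendsto_and_summable_of_quasi_descent (fun k => sq_nonneg _)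
      (fun k => mul_nonneg hτ.le (mul_nonneg (hα k) (sub_nonneg.2 (hy _)))) hc hcs (h y)
  obtain ⟨⟨L, hL⟩, hsum⟩ := hmain xstar hmin
  have hsum' : Summable fun k => α k * (F (x k) - F xstar) := by
    have := hsum.mul_left τ⁻¹
    simpa [← mul_assoc, inv_mul_cancel₀ hτ.ne'] using this
  -- Along θ the values tend to the minimum; boundedness then yields a cluster point w, itself a
  -- minimizer by continuity.
  obtain ⟨θ, hθ, hθF⟩ := extraction_forall_of_frequently
    (P := fun m k => F (x k) - F xstar < 1 / ((m : ℝ) + 1))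
    fun m => frequently_lt_of_summable_mul hα hdiv hsum' (by positivity)
  obtain ⟨R, hR⟩ := hL.bddAbove_range
  have hbdd : ∀ k, x (θ k) ∈ Metric.closedBall xstar (1 + R) := by
    intro k
    rw [mem_closedBall_iff_norm]
    have h1 : ‖x (θ k) - xstar‖ ^ 2 ≤ R := hR ⟨θ k, rfl⟩
    nlinarith [norm_nonneg (x (θ k) - xstar), sq_nonneg (‖x (θ k) - xstar‖ - 1)]
  obtain ⟨w, -, ψ, hψ, hw⟩ := (isCompact_closedBall xstar (1 + R)).tendsto_subseq hbdd
  have hFw : F w ≤ F xstar := by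
    have h1 : Tendsto (fun k => F (x (θ (ψ k)))) atTop (𝓝 (F w)) := (hF.tendsto w).comp hw
    have h2 : Tendsto (fun k : ℕ => F xstar + 1 / ((ψ k : ℝ) + 1)) atTop (𝓝 (F xstar)) := by
      have := (tendsto_one_div_add_atTop_nhds_zero_nat (𝕜 := ℝ)).comp hψ.tendsto_atTop
      simpa using this.const_add (F xstar)
    exact le_of_tendsto_of_tendsto' h1 h2 fun k => by linarith [hθF (ψ k)]
  -- The distances to the minimizer w converge along the whole sequence, and to 0 along a
  -- subsequence.
  obtain ⟨⟨L', hL'⟩, -⟩ := hmain w fun v => hFw.trans (hmin v)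
  have hzero : Tendsto (fun k => ‖x (θ (ψ k)) - w‖ ^ 2) atTop (𝓝 0) := by
    have := ((tendsto_iff_norm_sub_tendsto_zero.1 hw).pow 2)
    simpa using this
  have hL'0 : L' = 0 :=
    tendsto_nhds_unique (hL'.comp (hθ.tendsto_atTop.comp hψ.tendsto_atTop)) hzero
  rw [hL'0] at hL'
  refine ⟨w, tendsto_iff_norm_sub_tendsto_zero.2 ?_⟩
  have := hL'.sqrt
  simpa [Real.sqrt_sq (norm_nonneg _)] using this

/-! ### Matrices acting on tuples of vectors -/

section Action

variable {m E : Type*} [Fintype m] [NormedAddCommGroup E] [NormedSpace ℝ E]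

/-- A real matrix acting on tuples of vectors. -/
def act (P : Matrix m m ℝ) (w : m → E) (i : m) : E := ∑ j, P i j • w j

theorem act_mul (P Q : Matrix m m ℝ) (w : m → E) : act (P * Q) w = act P (act Q w) := by
  funext i
  simp only [act, mul_apply, Finset.sum_smul, Finset.smul_sum, smul_smul]
  exact Finset.sum_comm

theorem act_add (P : Matrix m m ℝ) (v w : m → E) : act P (v + w) = act P v + act P w := by
  funext i
  simp [act, Finset.sum_add_distrib]

theorem act_smul (P : Matrix m m ℝ) (a : ℝ) (w : m → E) : act P (a • w) = a • act P w := by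
  funext i
  simp only [act, Pi.smul_apply, Finset.smul_sum]
  exact Finset.sum_congr rfl fun j _ => smul_comm _ _ _

theorem norm_act_le {P : Matrix m m ℝ} {w : m → E} {K H : ℝ} (hP : ∀ i j, |P i j| ≤ K)
    (hw : ∀ j, ‖w j‖ ≤ H) (i : m) : ‖act P w i‖ ≤ Fintype.card m * K * H := by
  calc ‖act P w i‖ ≤ ∑ _j : m, K * H := by
        refine norm_sum_le_of_le _ fun j _ => ?_
        rw [norm_smul, Real.norm_eq_abs]
        exact mul_le_mul (hP i j) (hw j) (norm_nonneg _) ((abs_nonneg _).trans (hP i j))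
    _ = Fintype.card m * K * H := by
        rw [Finset.sum_const, Finset.card_univ, nsmul_eq_mul, mul_assoc]

variable [DecidableEq m]

theorem norm_le_of_linear_recurrence {P : Matrix m m ℝ} {K γ H : ℝ}
    (hP : ∀ k i j, |(P ^ k) i j| ≤ K * γ ^ k) {α u : ℕ → ℝ} (hα : ∀ k, 0 ≤ α k)
    {w h : ℕ → m → E} (hh : ∀ k j, ‖h k j‖ ≤ H)
    (hw : ∀ k, w (k + 1) = act P (w k) + α k • h k) {W : ℝ} (hW : ∀ j, ‖w 0 j‖ ≤ W)
    (hu0 : u 0 = Fintype.card m * K * W)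
    (hu : ∀ k, u (k + 1) = γ * u k + Fintype.card m * K * H * α k) (k : ℕ) (i : m) :
    ‖w k i‖ ≤ u k := by
  -- Strengthened to all further powers P^r: a single application of P need not contract, so the
  -- bound on w k alone does not propagate.
  have key : ∀ k r i, ‖act (P ^ r) (w k) i‖ ≤ γ ^ r * u k := by
    intro k
    induction k with
    | zero =>
      intro r i
      rw [hu0]
      exact (norm_act_le (hP r) hW i).trans (le_of_eq (by ring))
    | succ k ih =>
      intro r i
      rw [hw, act_add, ← act_mul, ← pow_succ, act_smul, Pi.add_apply, Pi.smul_apply, hu]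
      refine (norm_add_le _ _).trans ?_
      rw [norm_smul, Real.norm_of_nonneg (hα k)]
      have h1 := ih (r + 1) i
      have h2 := mul_le_mul_of_nonneg_left (norm_act_le (hP r) (hh k) i) (hα k)
      rw [pow_succ γ] at h1
      linarith
  simpa [act, one_apply] using key k 0 i

end Action

/-! ### The deviation and the mean of the iterates -/

section Iterates

variable {n p : ℕ} {f : Fin n → EuclideanSpace ℝ (Fin p) → ℝ} {A B : Matrix (Fin n) (Fin n) ℝ}
  {ε : ℝ} {α : ℕ → ℝ} {z : ℕ → Fin n ⊕ Fin n → EuclideanSpace ℝ (Fin p)}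
  {g : ℕ → Fin n → EuclideanSpace ℝ (Fin p)}

/-- The deviation from consensus. -/
noncomputable def deviation (z : Fin n ⊕ Fin n → EuclideanSpace ℝ (Fin p)) :
    Fin n ⊕ Fin n → EuclideanSpace ℝ (Fin p) :=
  act (1 - limitMatrix n) z

theorem deviation_inl (k : ℕ) (i : Fin n) :
    deviation (z k) (Sum.inl i) = z k (Sum.inl i) - accPoint z k := by
  simp [deviation, act, limitMatrix, accPoint, sub_smul, Finset.sum_sub_distrib, one_apply,
    Finset.smul_sum, smul_add]

theorem deviation_inr (k : ℕ) (i : Fin n) :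
    deviation (z k) (Sum.inr i) = z k (Sum.inr i) := by
  simp [deviation, act, limitMatrix, one_apply]

/-- Rests on (1 - L)M = M - L = (M - L)(1 - L), since LM = ML = L² = L. -/
theorem deviation_succ (hn : 1 ≤ n) (hA : ∀ i, ∑ j, A i j = 1) (hB : ∀ j, ∑ i, B i j = 1)
    (hz : ∀ k i, z (k + 1) i = ∑ j, weightMatrix A B ε i j • z k j -
      α k • Sum.elim (g k) (fun _ => 0) i) (k : ℕ) :
    deviation (z (k + 1)) = act (weightMatrix A B ε - limitMatrix n) (deviation (z k)) +
      α k • act (1 - limitMatrix n) (-Sum.elim (g k) (fun _ => 0)) := by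
  have hz' : z (k + 1) = act (weightMatrix A B ε) (z k) +
      α k • (-Sum.elim (g k) (fun _ => 0)) := by
    funext i
    rw [hz]
    simp [act, sub_eq_add_neg]
  have hmat : (1 - limitMatrix n) * weightMatrix A B ε =
      (weightMatrix A B ε - limitMatrix n) * (1 - limitMatrix n) := by
    rw [sub_mul, one_mul, limitMatrix_mul (weightMatrix_col_sum hB ε), mul_sub, mul_one, sub_mul,
      weightMatrix_mul_limitMatrix hA, limitMatrix_mul (limitMatrix_col_sum hn), sub_self, sub_zero]
  rw [deviation, hz', act_add, ← act_mul, hmat, act_mul, act_smul]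
  rfl

theorem accPoint_succ (hB : ∀ j, ∑ i, B i j = 1)
    (hz : ∀ k i, z (k + 1) i = ∑ j, weightMatrix A B ε i j • z k j -
      α k • Sum.elim (g k) (fun _ => 0) i) (k : ℕ) :
    accPoint z (k + 1) = accPoint z k - (α k / n) • ∑ i, g k i := by
  have h1 : ∑ i, z (k + 1) i = ∑ j, z k j - α k • ∑ i, g k i := by
    simp only [hz, Finset.sum_sub_distrib]
    congr 1
    · rw [Finset.sum_comm]
      refine Finset.sum_congr rfl fun j _ => ?_
      rw [← Finset.sum_smul, weightMatrix_col_sum hB, one_smul]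
    · rw [← Finset.smul_sum, Fintype.sum_sum_type]
      simp
  rw [accPoint, h1, accPoint, smul_sub, smul_smul]
  congr 2
  ring

theorem exists_deviation_bound (hn : 1 ≤ n) {G : Digraph (Fin n)}
    (hG : StronglyConnected G) (hA : IsRowWeight G A)
    (hB : IsColWeight G B) (hε : 0 < ε) (hε' : ε < epsBound A B) (hα : IsStepSize α)
    (hz : ∀ k i, z (k + 1) i = ∑ j, weightMatrix A B ε i j • z k j -
      α k • Sum.elim (g k) (fun _ => 0) i) {D : ℝ} (hD : 0 ≤ D) (hg : ∀ k i, ‖g k i‖ ≤ D) :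
    ∃ u : ℕ → ℝ, (∀ k i, ‖deviation (z k) i‖ ≤ u k) ∧ Tendsto u atTop (𝓝 0) ∧
      Summable fun k => α k * u k := by
  obtain ⟨K, γ, -, hγ0, hγ1, hpow⟩ :=
    exists_geometric_bound_weightMatrix hn hG hA hB hε hε'
  obtain ⟨T, hT⟩ : ∃ T : ℝ, ∀ i j, |(1 - limitMatrix n) i j| ≤ T := by
    refine ⟨∑ i, ∑ j, |(1 - limitMatrix n) i j|, fun i j => ?_⟩
    exact (Finset.single_le_sum (f := fun j => |(1 - limitMatrix n) i j|)
      (fun _ _ => abs_nonneg _) (Finset.mem_univ j)).trans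
      (Finset.single_le_sum (f := fun i => ∑ j, |(1 - limitMatrix n) i j|)
        (fun _ _ => Finset.sum_nonneg fun _ _ => abs_nonneg _) (Finset.mem_univ i))
  set c : ℝ := Fintype.card (Fin n ⊕ Fin n) * K *
    (Fintype.card (Fin n ⊕ Fin n) * T * D) with hc
  set W : ℝ := ∑ j, ‖deviation (z 0) j‖
  set u : ℕ → ℝ := fun k => Nat.rec (Fintype.card (Fin n ⊕ Fin n) * K * W)
    (fun k v => γ * v + c * α k) k with hu
  have hsucc : ∀ k, u (k + 1) = γ * u k + c * α k := fun k => rfl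
  have hsq : Summable fun k => u k ^ 2 :=
    summable_sq_of_recurrence hγ0 hγ1 hα.sq_summable hsucc
  have hbound : ∀ k i, ‖deviation (z k) i‖ ≤ u k := by
    refine norm_le_of_linear_recurrence (w := fun k => deviation (z k)) (u := u) hpow hα.nonneg
      (h := fun k => act (1 - limitMatrix n) (-Sum.elim (g k) (fun _ => 0)))
      (fun k i => norm_act_le hT (fun j => ?_) i)
      (deviation_succ hn hA.row_sum hB.col_sum hz) (W := W) (fun j => ?_) rfl hsucc
    · rcases j with j | j
      · simpa using hg k j
      · simpa using hD
    · exact Finset.single_le_sum (f := fun j => ‖deviation (z 0) j‖) (fun _ _ => norm_nonneg _)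
        (Finset.mem_univ j)
  have hu0 : ∀ k, 0 ≤ u k := fun k => (norm_nonneg _).trans (hbound k (Sum.inl ⟨0, hn⟩))
  refine ⟨u, hbound, ?_, ?_⟩
  · have := hsq.tendsto_atTop_zero.sqrt
    simpa [Real.sqrt_sq (hu0 _)] using this
  -- Compares α_k u_k with α_k² + u_k².
  · refine Summable.of_nonneg_of_le (fun k => mul_nonneg (hα.nonneg k) (hu0 k)) (fun k => ?_)
      (hα.sq_summable.add hsq)
    nlinarith [sq_nonneg (α k - u k), sq_nonneg (α k), sq_nonneg (u k)]

/-- Expands the square of the mean's step. Subgradients are taken at z_i rather than at z̄; moving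
f_i to z̄ and moving the inner product to z̄ each cost D u_k, whence the error 4Dα_k u_k after
multiplication by 2α_k/n and summation over n agents. -/
theorem accPoint_quasi_fejer (hn : 1 ≤ n) (hf : ∀ i, ConvexOn ℝ Set.univ (f i))
    (hα : ∀ k, 0 ≤ α k) {D : ℝ} (hD : ∀ i x v, IsSubgradientAt (f i) v x → ‖v‖ ≤ D)
    (hg : ∀ k i, IsSubgradientAt (f i) (g k i) (z k (Sum.inl i)))
    (hstep : ∀ k, accPoint z (k + 1) = accPoint z k - (α k / n) • ∑ i, g k i)
    {u : ℕ → ℝ} (hu : ∀ k i, ‖z k (Sum.inl i) - accPoint z k‖ ≤ u k)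
    (y : EuclideanSpace ℝ (Fin p)) (k : ℕ) :
    ‖accPoint z (k + 1) - y‖ ^ 2 ≤ ‖accPoint z k - y‖ ^ 2 -
      2 / n * (α k * (∑ i, f i (accPoint z k) - ∑ i, f i y)) +
      (4 * D * (α k * u k) + D ^ 2 * α k ^ 2) := by
  have hn0 : (0 : ℝ) < n := by exact_mod_cast hn
  have hD0 : 0 ≤ D := (norm_nonneg _).trans (hD _ _ _ (hg k ⟨0, hn⟩))
  set w := accPoint z k with hw
  have hinner : ∀ i, f i w - f i y - 2 * D * u k ≤ inner ℝ (g k i) (w - y) := by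
    intro i
    -- The bounded subgradient v at z̄ gives f_i(z_i) ≥ f_i(z̄) - D u_k.
    have h1 := hg k i y
    obtain ⟨v, hv⟩ := exists_isSubgradientAt (hf i) w
    have h2 := hv (z k (Sum.inl i))
    have h3 : |inner ℝ v (z k (Sum.inl i) - w)| ≤ D * u k :=
      (abs_real_inner_le_norm _ _).trans
        (mul_le_mul (hD i w v hv) (hu k i) (norm_nonneg _) hD0)
    have h4 : |inner ℝ (g k i) (z k (Sum.inl i) - w)| ≤ D * u k :=
      (abs_real_inner_le_norm _ _).trans
        (mul_le_mul (hD i _ _ (hg k i)) (hu k i) (norm_nonneg _) hD0)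
    have h5 : inner ℝ (g k i) (w - y) = -inner ℝ (g k i) (y - z k (Sum.inl i)) -
        inner ℝ (g k i) (z k (Sum.inl i) - w) := by
      simp only [inner_sub_right]
      ring
    have h6 := neg_abs_le (inner ℝ v (z k (Sum.inl i) - w))
    have h7 := le_abs_self (inner ℝ (g k i) (z k (Sum.inl i) - w))
    linarith
  have hsum : ∑ i, f i w - ∑ i, f i y - n * (2 * D * u k) ≤ inner ℝ (∑ i, g k i) (w - y) := by
    rw [sum_inner]
    have h1 := Finset.sum_le_sum fun i (_ : i ∈ Finset.univ) => hinner i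
    simp only [Finset.sum_sub_distrib, Finset.sum_const, Finset.card_univ, Fintype.card_fin,
      nsmul_eq_mul] at h1
    exact h1
  have hnorm : ‖∑ i, g k i‖ ≤ n * D := by
    calc ‖∑ i, g k i‖ ≤ ∑ _i : Fin n, D := norm_sum_le_of_le _ fun i _ => hD i _ _ (hg k i)
      _ = n * D := by simp
  have hsq : ‖∑ i, g k i‖ ^ 2 ≤ (n * D) ^ 2 := by gcongr
  have hexp : ‖accPoint z (k + 1) - y‖ ^ 2 = ‖w - y‖ ^ 2 -
      2 * (α k / n) * inner ℝ (∑ i, g k i) (w - y) + (α k / n) ^ 2 * ‖∑ i, g k i‖ ^ 2 := by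
    rw [hstep, sub_right_comm, norm_sub_sq_real, inner_smul_right, norm_smul, mul_pow,
      Real.norm_eq_abs, sq_abs, real_inner_comm]
    ring
  have hα' : 0 ≤ 2 * (α k / n) := by have := hα k; positivity
  have h1 := mul_le_mul_of_nonneg_left hsum hα'
  have h2 := mul_le_mul_of_nonneg_left hsq (sq_nonneg (α k / n))
  have h3 : (α k / n) ^ 2 * (n * D) ^ 2 = D ^ 2 * α k ^ 2 := by field_simp
  have h4 : 2 * (α k / n) * (∑ i, f i w - ∑ i, f i y - n * (2 * D * u k)) =
      2 / n * (α k * (∑ i, f i w - ∑ i, f i y)) - 4 * D * (α k * u k) := by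
    field_simp
    ring
  rw [hexp]
  linarith

end Iterates

end DDGD

/-! ### The main theorem -/

theorem mainTheorem2 {n p : ℕ} (hn : 1 ≤ n) (G : Digraph (Fin n))
    (f : Fin n → EuclideanSpace ℝ (Fin p) → ℝ) (hA1 : DDGD.Assumptions G f)
    (A B : Matrix (Fin n) (Fin n) ℝ) (hA : DDGD.IsRowWeight G A) (hB : DDGD.IsColWeight G B)
    (ε : ℝ) (hε : 0 < ε) (hε' : ε < DDGD.epsBound A B)
    (α : ℕ → ℝ) (hα : DDGD.IsStepSize α)
    (z : ℕ → Fin n ⊕ Fin n → EuclideanSpace ℝ (Fin p)) (hz : DDGD.IsIterates f A B ε α z) :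
    (∀ i : Fin n,
      Summable fun k : ℕ => α (k + 1) * ‖z (k + 1) (Sum.inl i) - DDGD.accPoint z (k + 1)‖) ∧
    (∀ i : Fin n, Summable fun k : ℕ => α (k + 1) * ‖z (k + 1) (Sum.inr i)‖) ∧
    (∀ i : Fin n,
      Tendsto (fun k => ‖z k (Sum.inl i) - DDGD.accPoint z k‖) atTop (𝓝 0)) ∧
    (∃ zlim : EuclideanSpace ℝ (Fin p),
      Tendsto (fun k => DDGD.accPoint z k) atTop (𝓝 zlim) ∧
      ∀ i : Fin n, Tendsto (fun k => z k (Sum.inl i)) atTop (𝓝 zlim)) ∧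
    (∀ i : Fin n, Tendsto (fun k => z k (Sum.inr i)) atTop (𝓝 0)) := by
  choose g hg hstep using hz
  obtain ⟨D, hD⟩ := hA1.bounded_subgradients
  have hD0 : 0 ≤ D := (norm_nonneg _).trans (hD _ _ _ (hg 0 ⟨0, hn⟩))
  obtain ⟨u, hu, hulim, husum⟩ := DDGD.exists_deviation_bound hn hA1.strongly_connected hA hB hε hε'
    hα hstep hD0 fun k i => hD _ _ _ (hg k i)
  have hsummable : ∀ i, Summable fun k => α k * ‖DDGD.deviation (z k) i‖ := fun i =>
    Summable.of_nonneg_of_le (fun k => mul_nonneg (hα.nonneg k) (norm_nonneg _))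
      (fun k => mul_le_mul_of_nonneg_left (hu k i) (hα.nonneg k)) husum
  have htendsto : ∀ i, Tendsto (fun k => ‖DDGD.deviation (z k) i‖) atTop (𝓝 0) := fun i =>
    squeeze_zero (fun k => norm_nonneg _) (fun k => hu k i) hulim
  have huinl : ∀ k i, ‖z k (Sum.inl i) - DDGD.accPoint z k‖ ≤ u k := fun k i => by
    rw [← DDGD.deviation_inl]
    exact hu k _
  have hu0 : ∀ k, 0 ≤ u k := fun k => (norm_nonneg _).trans (hu k (Sum.inl ⟨0, hn⟩))
  have hcons : ∀ i, Tendsto (fun k => ‖z k (Sum.inl i) - DDGD.accPoint z k‖) atTop (𝓝 0) :=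
    fun i => by simpa only [DDGD.deviation_inl] using htendsto (Sum.inl i)
  refine ⟨fun i => ?_, fun i => ?_, hcons, ?_, fun i => ?_⟩
  -- The sums in the statement start at k = 1, hence the shift.
  · have := (summable_nat_add_iff 1).2 (hsummable (Sum.inl i))
    simpa only [DDGD.deviation_inl] using this
  · have := (summable_nat_add_iff 1).2 (hsummable (Sum.inr i))
    simpa only [DDGD.deviation_inr] using this
  · obtain ⟨xstar, hmin⟩ := hA1.exists_minimizer
    have hn0 : (0 : ℝ) < n := by exact_mod_cast hn
    obtain ⟨w, hw⟩ := DDGD.exists_tendsto_of_quasi_fejer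
      (F := fun x => ∑ i, f i x)
      (continuous_finsetSum _ fun i _ => (hA1.convex i).locallyLipschitz.continuous) hmin
      hα.nonneg hα.sum_eq_top
      (c := fun k => 4 * D * (α k * u k) + D ^ 2 * α k ^ 2)
      (fun k => by have := hα.nonneg k; have := hu0 k; positivity)
      ((husum.mul_left _).add (hα.sq_summable.mul_left _)) (τ := 2 / n) (by positivity)
      (x := DDGD.accPoint z)
      (DDGD.accPoint_quasi_fejer hn hA1.convex hα.nonneg hD hg
        (DDGD.accPoint_succ hB.col_sum hstep) huinl)
    refine ⟨w, hw, fun i => ?_⟩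
    have := (tendsto_zero_iff_norm_tendsto_zero.2 (hcons i)).add hw
    simpa using this
  · rw [tendsto_zero_iff_norm_tendsto_zero]
    simpa only [DDGD.deviation_inr] using htendsto (Sum.inr i)
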